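/- Let $\mathbb T=\mathbb R/2\pi\mathbb Z$ and $\delta>0$. There is a constant $C$, depending only on $\delta$, with the following property. Let $z=(z_1,z_2):\mathbb R\to\mathbb R^2$ be a horizontally $2\pi$-periodic curve, $z(\alpha+2\pi)=z(\alpha)+(2\pi,0)$, of class $C^{2,\delta}$ (that is, $z\in C^2$ and $\partial_\alpha^2z$ is $\delta$-Hölder continuous), and put $$\|z\|_{C^{2,\delta}}=\sum_{k=0}^{2}\ \sup_{|\alpha|\le\pi}|\partial_\alpha^k z(\alpha)|+\sup_{\alpha\ne\beta}\frac{|\partial_\alpha^2z(\alpha)-\partial_\alpha^2z(\beta)|}{|\alpha-\beta|^\delta}.$$ Suppose that the arc-chord function $$\mathcal F(z)(\alpha,\beta)=\frac{\beta^2/4}{\tan^2\big(\frac{z_1(\alpha)-z_1(\alpha-\beta)}2\big)+\tanh^2\big(\frac{z_2(\alpha)-z_2(\alpha-\beta)}2\big)}\quad(\beta\neq0),\qquad \mathcal F(z)(\alpha,0)=\frac1{|\partial_\alpha z(\alpha)|^2},$$ with values in $[0,\infty]$, satisfies $\|\mathcal F(z)\|_{L^\infty}=\operatorname{ess\,sup}_{\alpha,\beta\in(-\pi,\pi)}\mathcal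 F(z)(\alpha,\beta)<\infty$. For $u\in L^2(\mathbb T)$ let $$BR(z,u)(\alpha)=\Big(-\frac1{4\pi}PV\!\!\int_{\mathbb T}u(\beta)\frac{V_2(1+V_1^2)}{V_1^2+V_2^2}\,d\beta,\ \ \frac1{4\pi}PV\!\!\int_{\mathbb T}u(\beta)\frac{V_1(1-V_2^2)}{V_1^2+V_2^2}\,d\beta\Big),$$ where $V_1=\tan\frac{z_1(\alpha)-z_1(\beta)}2$, $V_2=\tanh\frac{z_2(\alpha)-z_2(\beta)}2$ and $PV\int_{\mathbb T}=\lim_{\varepsilon\to0^+}\int_{\varepsilon<|\alpha-\beta|<\pi}$. (At the poles of the tangent, $\mathcal F(z)$ and the two kernels are given their limiting values $0$ and $V_2$, $0$.) Then for every $u\in L^2(\mathbb T)$ these principal values exist for almost every $\alpha$, and the operator $$T(u)(\alpha)=2\,BR(z,u)(\alpha)\cdot\partial_\alpha z(\alpha)$$ is a bounded linear operator from $L^2(\mathbb T)$ to $H^1(\mathbb T)$, where $\|f\|_{H^1}^2=\|f\|_{L^2}^2+\|\partial_\alpha f\|_{L^2}^2$ with $\partial_\alpha f$ the weak derivative, and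 $$\|T\|_{L^2\to H^1}\le C\,\|\mathcal F(z)\|_{L^\infty}^2\,\|z\|_{C^{2,\delta}}^4.$$ -/

import Mathlib

open MeasureTheory Filter Topology Real
open scoped ENNReal NNReal ContDiff

noncomputable section

namespace Muskat

instance factTwoPiPos : Fact (0 < 2 * π) := ⟨Real.two_pi_pos⟩

/-- The circle `𝕋 = ℝ / 2πℤ`; its measure `volume` is Lebesgue measure, of total mass `2π`. -/
abbrev Torus : Type := AddCircle (2 * π)

/-- The real Hilbert space `L²(𝕋)`. -/
abbrev L2 : Type := Lp ℝ 2 (volume : Measure Torus)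

/-- The plane with its Euclidean norm and dot product. -/
abbrev Plane : Type := EuclideanSpace ℝ (Fin 2)

/-! ### The Sobolev space `H¹(𝕋)` -/

/-- `g` is the weak derivative of `f` on the circle: `∫ f φ' = - ∫ g φ` for all smooth
`2π`-periodic `φ`. -/
def IsWeakDeriv (f g : Torus → ℝ) : Prop :=
  ∀ φ : ℝ → ℝ, ContDiff ℝ ∞ φ → Function.Periodic φ (2 * π) →
    ∫ x in (-π)..π, f (x : Torus) * deriv φ x = -∫ x in (-π)..π, g (x : Torus) * φ x

theorem ae_torus {p : Torus → Prop} (h : ∀ᵐ x : Torus, p x) :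
    ∀ᵐ x : ℝ, x ∈ Set.Ioc (-π) π → p (x : Torus) := by
  have hm := AddCircle.measurePreserving_mk (2 * π) (-π)
  rw [show -π + 2 * π = π by ring] at hm
  exact (ae_restrict_iff' measurableSet_Ioc).1 (hm.quasiMeasurePreserving.ae h)

theorem intervalIntegrable_mul (f : L2) {ψ : ℝ → ℝ} (hψ : Continuous ψ) :
    IntervalIntegrable (fun x : ℝ => f (x : Torus) * ψ x) volume (-π) π := by
  have hm := AddCircle.measurePreserving_mk (2 * π) (-π)
  rw [show -π + 2 * π = π by ring] at hm
  have h1 : Integrable (fun x : Torus => f x) := (Lp.memLp f).integrable (by norm_num)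
  have h2 : Integrable (fun x : ℝ => f (x : Torus)) (volume.restrict (Set.Ioc (-π) π)) :=
    hm.integrable_comp_of_integrable h1
  have h3 : IntervalIntegrable (fun x : ℝ => f (x : Torus)) volume (-π) π :=
    (intervalIntegrable_iff_integrableOn_Ioc_of_le (by linarith [Real.pi_pos])).2 h2
  exact h3.mul_continuousOn hψ.continuousOn

theorem integral_congr_torus {f g : Torus → ℝ} (h : f =ᵐ[volume] g) (ψ : ℝ → ℝ) :
    ∫ x in (-π)..π, f (x : Torus) * ψ x = ∫ x in (-π)..π, g (x : Torus) * ψ x := by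
  apply intervalIntegral.integral_congr_ae
  filter_upwards [ae_torus h] with x hx hx'
  rw [Set.uIoc_of_le (by linarith [Real.pi_pos])] at hx'
  simp only [hx hx']

/-- The Sobolev space `H¹(𝕋)`: the pairs `(f, f')` with `f, f' ∈ L²(𝕋)` and `f'` the weak
derivative of `f`, a subspace of the Hilbert sum `L² ⊕ L²`. Its inherited norm is
`‖f‖_{H¹} = (‖f‖²_{L²} + ‖f'‖²_{L²})^{1/2}`. -/
def H1 : Submodule ℝ (WithLp 2 (L2 × L2)) where
  carrier := {p | IsWeakDeriv p.fst p.snd}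
  add_mem' := by
    intro p q hp hq φ hφ hper
    have c0 : Continuous φ := hφ.continuous
    have c1 : Continuous (deriv φ) := hφ.continuous_deriv (by simp)
    rw [integral_congr_torus (f := (p + q).fst) (Lp.coeFn_add p.fst q.fst),
      integral_congr_torus (f := (p + q).snd) (Lp.coeFn_add p.snd q.snd)]
    simp only [Pi.add_apply, add_mul]
    rw [intervalIntegral.integral_add (intervalIntegrable_mul _ c1) (intervalIntegrable_mul _ c1),
      intervalIntegral.integral_add (intervalIntegrable_mul _ c0) (intervalIntegrable_mul _ c0),
      hp φ hφ hper, hq φ hφ hper]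
    ring
  zero_mem' := by
    intro φ hφ hper
    rw [integral_congr_torus (f := (0 : WithLp 2 (L2 × L2)).fst) (Lp.coeFn_zero ℝ 2 volume),
      integral_congr_torus (f := (0 : WithLp 2 (L2 × L2)).snd) (Lp.coeFn_zero ℝ 2 volume)]
    simp
  smul_mem' := by
    intro c p hp φ hφ hper
    rw [integral_congr_torus (f := (c • p).fst) (Lp.coeFn_smul c p.fst),
      integral_congr_torus (f := (c • p).snd) (Lp.coeFn_smul c p.snd)]
    simp only [Pi.smul_apply, smul_eq_mul, mul_assoc, intervalIntegral.integral_const_mul]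
    rw [hp φ hφ hper]
    ring

/-- The underlying function (class) in `L²(𝕋)` of an element of `H¹(𝕋)`. -/
def H1.toL2 (f : H1) : L2 := f.1.fst

/-! ### Curves -/

/-- `z` parametrizes a curve that is `2π`-periodic in the horizontal direction. -/
def IsPeriodicCurve (z : ℝ → Plane) : Prop :=
  ∀ α : ℝ, z (α + 2 * π) = z α + !₂[2 * π, 0]

/-- `z ∈ C^{2,δ}`: twice continuously differentiable, with `δ`-Hölder second derivative. -/
def IsC2Holder (δ : ℝ≥0) (z : ℝ → Plane) : Prop :=
  ContDiff ℝ 2 z ∧ MemHolder δ (iteratedDeriv 2 z)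

/-- The norm `‖z‖_{C^{2,δ}}`: the suprema over one period of `|z|`, `|∂z|`, `|∂²z|`, plus the
`δ`-Hölder seminorm of the periodic function `∂²z`. -/
def c2HolderNorm (δ : ℝ≥0) (z : ℝ → Plane) : ℝ≥0∞ :=
  (∑ k ∈ Finset.range 3, ⨆ α ∈ Set.Icc (-π) π, ‖iteratedDeriv k z α‖ₑ)
    + eHolderNorm δ (iteratedDeriv 2 z)

/-- The arc-chord function `ℱ(z)(α, β)`, with values in `[0, ∞]`. Its value is `1 / |∂z(α)|²` at
`β = 0`, and `0` (the limit) where the tangent has a pole. -/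
def arcChord (z : ℝ → Plane) (α β : ℝ) : ℝ≥0∞ :=
  if β = 0 then (‖deriv z α‖ₑ ^ 2)⁻¹
  else if cos ((z α 0 - z (α - β) 0) / 2) = 0 then 0
  else ENNReal.ofReal (β ^ 2 / 4) /
    ENNReal.ofReal (tan ((z α 0 - z (α - β) 0) / 2) ^ 2 + tanh ((z α 1 - z (α - β) 1) / 2) ^ 2)

/-- `‖ℱ(z)‖_{L^∞}`, the essential supremum over `α, β ∈ (-π, π)`. -/
def arcChordNorm (z : ℝ → Plane) : ℝ≥0∞ :=
  essSup (fun p : ℝ × ℝ => arcChord z p.1 p.2)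
    (volume.restrict (Set.Ioo (-π) π ×ˢ Set.Ioo (-π) π))

/-! ### The Birkhoff-Rott integral -/

/-- `tanh(y/2) (1 + tan²(x/2)) / (tan²(x/2) + tanh²(y/2))`, with its limit `tanh(y/2)` at the poles
of `tan(x/2)`. -/
def kernel₁ (x y : ℝ) : ℝ :=
  if cos (x / 2) = 0 then tanh (y / 2)
  else tanh (y / 2) * (1 + tan (x / 2) ^ 2) / (tan (x / 2) ^ 2 + tanh (y / 2) ^ 2)

/-- `tan(x/2) (1 - tanh²(y/2)) / (tan²(x/2) + tanh²(y/2))`, with its limit `0` at the poles of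
`tan(x/2)`. -/
def kernel₂ (x y : ℝ) : ℝ :=
  if cos (x / 2) = 0 then 0
  else tan (x / 2) * (1 - tanh (y / 2) ^ 2) / (tan (x / 2) ^ 2 + tanh (y / 2) ^ 2)

theorem tan_tanh_aux {x y : ℝ} (hc : cos (x / 2) ≠ 0) :
    tan (x / 2) ^ 2 + tanh (y / 2) ^ 2 =
      (cosh y - cos x) / (2 * (cos (x / 2) ^ 2 * cosh (y / 2) ^ 2)) := by
  have hh := (Real.cosh_pos (y / 2)).ne'
  have e1 : cos x = 2 * cos (x / 2) ^ 2 - 1 := by rw [← Real.cos_two_mul]; ring_nf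
  have e2 : cosh y = cosh (y / 2) ^ 2 + sinh (y / 2) ^ 2 := by rw [← Real.cosh_two_mul]; ring_nf
  have e3 := Real.sin_sq_add_cos_sq (x / 2)
  have e4 := Real.cosh_sq (y / 2)
  have e5 : sin (x / 2) ^ 2 = 1 - cos (x / 2) ^ 2 := by linarith
  rw [Real.tan_eq_sin_div_cos, Real.tanh_eq_sinh_div_cosh, e1, e2]
  field_simp
  rw [e5, e4]
  ring

/-- Closed form of the first kernel, valid also at the poles of the tangent. -/
theorem kernel₁_eq (x y : ℝ) : kernel₁ x y = sinh y / (cosh y - cos x) := by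
  have hh := (Real.cosh_pos (y / 2)).ne'
  have e1 : cos x = 2 * cos (x / 2) ^ 2 - 1 := by rw [← Real.cos_two_mul]; ring_nf
  have e2 : cosh y = cosh (y / 2) ^ 2 + sinh (y / 2) ^ 2 := by rw [← Real.cosh_two_mul]; ring_nf
  have e3 : sinh y = 2 * sinh (y / 2) * cosh (y / 2) := by rw [← Real.sinh_two_mul]; ring_nf
  have e4 := Real.cosh_sq (y / 2)
  unfold kernel₁
  split_ifs with hc
  · have e6 : cosh y - cos x = 2 * cosh (y / 2) ^ 2 := by rw [e1, e2, hc, e4]; ring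
    rw [e6, e3, Real.tanh_eq_sinh_div_cosh]
    field_simp
  · have e5 : 1 + tan (x / 2) ^ 2 = 1 / cos (x / 2) ^ 2 := by
      rw [Real.tan_eq_sin_div_cos]
      field_simp
      linarith [Real.sin_sq_add_cos_sq (x / 2)]
    rw [tan_tanh_aux hc, e5, e3, Real.tanh_eq_sinh_div_cosh]
    rcases eq_or_ne (cosh y - cos x) 0 with h0 | h0
    · simp [h0]
    · field_simp

/-- Closed form of the second kernel, valid also at the poles of the tangent. -/
theorem kernel₂_eq (x y : ℝ) : kernel₂ x y = sin x / (cosh y - cos x) := by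
  have hh := (Real.cosh_pos (y / 2)).ne'
  have e3 : sin x = 2 * sin (x / 2) * cos (x / 2) := by rw [← Real.sin_two_mul]; ring_nf
  unfold kernel₂
  split_ifs with hc
  · simp [e3, hc]
  · have e5 : 1 - tanh (y / 2) ^ 2 = 1 / cosh (y / 2) ^ 2 := by
      rw [Real.tanh_eq_sinh_div_cosh]
      field_simp
      linarith [Real.cosh_sq (y / 2)]
    rw [tan_tanh_aux hc, e5, e3, Real.tan_eq_sin_div_cos]
    rcases eq_or_ne (cosh y - cos x) 0 with h0 | h0
    · simp [h0]
    · field_simp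

/-- The principal value of `∫_𝕋 f(β) dβ` with singularity at `α`, for a `2π`-periodic `f`, exists
and equals `l`. -/
def HasPV (f : ℝ → ℝ) (α l : ℝ) : Prop :=
  (∀ ε > 0, IntegrableOn f {β | ε < |α - β| ∧ |α - β| < π}) ∧
    Tendsto (fun ε : ℝ => ∫ β in {β | ε < |α - β| ∧ |α - β| < π}, f β) (𝓝[>] 0) (𝓝 l)

/-- `b` is the value `BR(z, u)(α)` of the Birkhoff-Rott integral, whose two components are principal
values. -/
def HasBR (z : ℝ → Plane) (u : Torus → ℝ) (α : ℝ) (b : Plane) : Prop :=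
  ∃ l₁ l₂ : ℝ,
    HasPV (fun β => u (β : Torus) * kernel₁ (z α 0 - z β 0) (z α 1 - z β 1)) α l₁ ∧
    HasPV (fun β => u (β : Torus) * kernel₂ (z α 0 - z β 0) (z α 1 - z β 1)) α l₂ ∧
    b = !₂[-(1 / (4 * π)) * l₁, 1 / (4 * π) * l₂]

open Classical in
/-- The Birkhoff-Rott integral `BR(z, u)(α)` (zero where the principal values do not exist). -/
def BR (z : ℝ → Plane) (u : Torus → ℝ) (α : ℝ) : Plane :=
  if h : ∃ b, HasBR z u α b then h.choose else 0

/-- `T(u)(α) = 2 BR(z, u)(α) · ∂z(α)`. -/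
def opT (z : ℝ → Plane) (u : Torus → ℝ) (α : ℝ) : ℝ :=
  2 * inner ℝ (BR z u α) (deriv z α)

end Muskat

end

noncomputable section

namespace Muskat

/-! ### The cotangent near the origin -/

/-! Write the curve as ζ = z₁ + i z₂. The two Birkhoff-Rott kernels are the real part and minus the
imaginary part of cot((ζ(α) - ζ(β))/2) (`cos_div_sin_eq_kernel`), so T has the kernel Im K / 2π,
where K(α, β) = cot((ζ(α) - ζ(β))/2) ζ'(α).

Near the diagonal K = 2/(α - β) + O(1) and ∂_α K = -2/(α - β)² + O(1 + |α - β|^(δ-1)). The singular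
terms do not depend on the curve and are real, so they drop out of the imaginary part: Im K is
bounded (`abs_im_cotKernel_le`) and Im ∂_α K is weakly singular (`abs_im_cotKernelDeriv_le`). Both
are dominated by an integrable convolution kernel, hence bounded on L² by Young's inequality. Im K
also extends continuously across the diagonal, so integrating by parts over one period leaves no
boundary term, and ∂_α K gives the weak derivative (`integral_torusKernel_mul_deriv`,
`IsDominated.exists_toH1`).

The separate components of BR are genuinely singular, so their principal values need the almost
everywhere existence of the conjugate function. For the model kernel cot((α - β)/2)
(`ae_exists_tendsto_truncCot`), the truncations are compared at Lebesgue points with conjugate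
Poisson integrals of u. These are Poisson integrals of the L² function with coefficients -i sgn(n)
û(n), and so converge. Since K - cot((α - β)/2) is bounded, the principal values along the curve
follow (`exists_tendsto_cot`).

With F and M the arc-chord and C^{2,δ} norms, the kernel bounds are linear in the chord-arc constant
640 F and at most quartic in M. The lower bound F ≥ 1/32 (`le_arcChordNorm`) gives that chord-arc
constant and turns F into F² in the final estimate. -/

theorem norm_sin_sub_self_le {v : ℂ} (hv : ‖v‖ ≤ 1 / 2) :
    ‖Complex.sin v - v‖ ≤ ‖v‖ ^ 3 / 5 := by
  have h1 := Complex.sin_bound (x := v) (by linarith)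
  have h0 := norm_nonneg v
  have h2 : ‖v ^ 3 / 6‖ = ‖v‖ ^ 3 / 6 := by simp
  have h3 : ‖Complex.sin v - v‖ ≤ ‖Complex.sin v - (v - v ^ 3 / 6)‖ + ‖v ^ 3 / 6‖ := by
    have := norm_sub_le (Complex.sin v - (v - v ^ 3 / 6)) (v ^ 3 / 6)
    rwa [show Complex.sin v - (v - v ^ 3 / 6) - v ^ 3 / 6 = Complex.sin v - v by ring] at this
  have h4 : ‖v‖ ^ 5 ≤ ‖v‖ ^ 3 := pow_le_pow_of_le_one h0 (by linarith) (by norm_num)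
  have h5 : 0 ≤ ‖v‖ ^ 3 := by positivity
  linarith

theorem norm_cos_sub_one_le {v : ℂ} (hv : ‖v‖ ≤ 1 / 2) : ‖Complex.cos v - 1‖ ≤ ‖v‖ ^ 2 := by
  have h1 := Complex.cos_bound (x := v) (by linarith)
  have h0 := norm_nonneg v
  have h2 : ‖v ^ 2 / 2‖ = ‖v‖ ^ 2 / 2 := by simp
  have h3 : ‖Complex.cos v - 1‖ ≤ ‖Complex.cos v - (1 - v ^ 2 / 2)‖ + ‖v ^ 2 / 2‖ := by
    have := norm_sub_le (Complex.cos v - (1 - v ^ 2 / 2)) (v ^ 2 / 2)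
    rwa [show Complex.cos v - (1 - v ^ 2 / 2) - v ^ 2 / 2 = Complex.cos v - 1 by ring] at this
  have h4 : ‖v‖ ^ 4 ≤ ‖v‖ ^ 2 := pow_le_pow_of_le_one h0 (by linarith) (by norm_num)
  have h5 : 0 ≤ ‖v‖ ^ 2 := by positivity
  linarith

theorem norm_sin_bounds {v : ℂ} (hv : ‖v‖ ≤ 1 / 2) :
    ‖v‖ / 2 ≤ ‖Complex.sin v‖ ∧ ‖Complex.sin v‖ ≤ 2 * ‖v‖ := by
  have h1 := norm_sin_sub_self_le hv
  have h0 := norm_nonneg v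
  have h2 : ‖v‖ ^ 3 ≤ ‖v‖ ^ 1 := pow_le_pow_of_le_one h0 (by linarith) (by norm_num)
  rw [pow_one] at h2
  have h3 := norm_sub_norm_le (Complex.sin v) v
  have h4 := norm_sub_norm_le v (Complex.sin v)
  rw [norm_sub_rev] at h4
  constructor <;> linarith

/-- Over the common denominator v sin v the numerator is cubic in v. The linear decay is what the
limit on the diagonal needs; size estimates use only boundedness. -/
theorem norm_cot_sub_inv_le_mul {v : ℂ} (hv : ‖v‖ ≤ 1 / 2) (h : v ≠ 0) :
    ‖Complex.cos v / Complex.sin v - 1 / v‖ ≤ 4 * ‖v‖ := by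
  obtain ⟨hl, -⟩ := norm_sin_bounds hv
  have h0 : 0 < ‖v‖ := norm_pos_iff.2 h
  have hs : Complex.sin v ≠ 0 := norm_pos_iff.1 (by linarith)
  have e : Complex.cos v / Complex.sin v - 1 / v
      = (v * (Complex.cos v - 1) - (Complex.sin v - v)) / (v * Complex.sin v) := by
    field_simp; ring
  rw [e, norm_div, norm_mul, div_le_iff₀ (by positivity)]
  calc _ ≤ ‖v * (Complex.cos v - 1)‖ + ‖Complex.sin v - v‖ := norm_sub_le _ _
    _ ≤ ‖v‖ * ‖v‖ ^ 2 + ‖v‖ ^ 3 / 5 := by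
      rw [norm_mul]
      gcongr
      · exact norm_cos_sub_one_le hv
      · exact norm_sin_sub_self_le hv
    _ ≤ 4 * ‖v‖ * (‖v‖ * (‖v‖ / 2)) := by nlinarith [mul_pos (mul_pos h0 h0) h0]
    _ ≤ _ := by gcongr

theorem norm_cot_sub_inv_le {v : ℂ} (hv : ‖v‖ ≤ 1 / 2) (h : v ≠ 0) :
    ‖Complex.cos v / Complex.sin v - 1 / v‖ ≤ 2 :=
  (norm_cot_sub_inv_le_mul hv h).trans (by linarith)

theorem norm_inv_sin_sq_sub_le {v : ℂ} (hv : ‖v‖ ≤ 1 / 2) (h : v ≠ 0) :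
    ‖1 / Complex.sin v ^ 2 - 1 / v ^ 2‖ ≤ 3 := by
  obtain ⟨hl, hu⟩ := norm_sin_bounds hv
  have h0 : 0 < ‖v‖ := norm_pos_iff.2 h
  have hs : Complex.sin v ≠ 0 := norm_pos_iff.1 (by linarith)
  have e : 1 / Complex.sin v ^ 2 - 1 / v ^ 2
      = (-(Complex.sin v - v) * (v + Complex.sin v)) / (v ^ 2 * Complex.sin v ^ 2) := by
    field_simp; ring
  rw [e, norm_div, norm_mul, norm_mul, norm_neg, norm_pow, norm_pow, div_le_iff₀ (by positivity)]
  calc _ ≤ ‖v‖ ^ 3 / 5 * (‖v‖ + ‖Complex.sin v‖) := by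
        gcongr
        · exact norm_sin_sub_self_le hv
        · exact norm_add_le _ _
    _ ≤ ‖v‖ ^ 3 / 5 * (3 * ‖v‖) := by gcongr; linarith
    _ ≤ 3 * (‖v‖ ^ 2 * (‖v‖ / 2) ^ 2) := by
      have : 0 < ‖v‖ ^ 4 := by positivity
      nlinarith
    _ ≤ _ := by gcongr

/-! ### Chord-arc curves in the complex plane -/

/-- `ζ` is a horizontally `2π`-periodic curve with derivatives `ζ₁`, `ζ₂`, with `C^{2,δ}` bounds `M`
and with chord-arc constant `B`. -/
structure IsChordArc (δ M B : ℝ) (ζ ζ₁ ζ₂ : ℝ → ℂ) : Prop where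
  one_le_M : 1 ≤ M
  one_le_B : 1 ≤ B
  delta_pos : 0 < δ
  hasDeriv : ∀ α, HasDerivAt ζ (ζ₁ α) α
  hasDeriv₁ : ∀ α, HasDerivAt ζ₁ (ζ₂ α) α
  cont₂ : Continuous ζ₂
  norm₁ : ∀ α, ‖ζ₁ α‖ ≤ M
  norm₂ : ∀ α, ‖ζ₂ α‖ ≤ M
  holder : ∀ α β, ‖ζ₂ α - ζ₂ β‖ ≤ M * |α - β| ^ δ
  ne_zero : ∀ α, ζ₁ α ≠ 0
  per : ∀ α, ζ (α + 2 * π) = ζ α + 2 * π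
  per₁ : ∀ α, ζ₁ (α + 2 * π) = ζ₁ α
  per₂ : ∀ α, ζ₂ (α + 2 * π) = ζ₂ α
  arc_sin : ∀ α β, |α - β| ≤ π → (α - β) ^ 2 ≤ B * ‖Complex.sin ((ζ α - ζ β) / 2)‖ ^ 2
  arc_cos : ∀ α β, |α - β| ≤ π → (α - β) ^ 2 * ‖Complex.cos ((ζ α - ζ β) / 2)‖ ^ 2
    ≤ B * ‖Complex.sin ((ζ α - ζ β) / 2)‖ ^ 2

/-- The complex kernel `cot ((ζ(α) - ζ(β)) / 2) ∂ζ(α)`. -/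
def cotKernel (ζ ζ₁ : ℝ → ℂ) (α β : ℝ) : ℂ :=
  Complex.cos ((ζ α - ζ β) / 2) / Complex.sin ((ζ α - ζ β) / 2) * ζ₁ α

/-- The derivative in `α` of `cotKernel`. -/
def cotKernelDeriv (ζ ζ₁ ζ₂ : ℝ → ℂ) (α β : ℝ) : ℂ :=
  -(ζ₁ α ^ 2 / 2 * (1 / Complex.sin ((ζ α - ζ β) / 2) ^ 2)) +
    Complex.cos ((ζ α - ζ β) / 2) / Complex.sin ((ζ α - ζ β) / 2) * ζ₂ α

namespace IsChordArc

variable {δ M B : ℝ} {ζ ζ₁ ζ₂ : ℝ → ℂ}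

theorem M_pos (H : IsChordArc δ M B ζ ζ₁ ζ₂) : 0 < M := by linarith [H.one_le_M]

theorem B_pos (H : IsChordArc δ M B ζ ζ₁ ζ₂) : 0 < B := by linarith [H.one_le_B]

/-! ### Taylor expansions of the curve, and chord-arc lower bounds. -/

theorem taylor_zero (H : IsChordArc δ M B ζ ζ₁ ζ₂) (α β : ℝ) :
    ‖ζ α - ζ β‖ ≤ M * |α - β| :=
  convex_univ.norm_image_sub_le_of_norm_hasDerivWithin_le
    (fun x _ => (H.hasDeriv x).hasDerivWithinAt) (fun x _ => H.norm₁ x) trivial trivial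

theorem taylor_one_deriv (H : IsChordArc δ M B ζ ζ₁ ζ₂) (α β : ℝ) :
    ‖ζ₁ α - ζ₁ β‖ ≤ M * |α - β| :=
  convex_univ.norm_image_sub_le_of_norm_hasDerivWithin_le
    (fun x _ => (H.hasDeriv₁ x).hasDerivWithinAt) (fun x _ => H.norm₂ x) trivial trivial

/-- Mean value inequality for t ↦ ζ(t) - t ζ₁(α). The expansion is centred at α because the kernel
carries the factor ζ₁(α). -/
theorem taylor_one (H : IsChordArc δ M B ζ ζ₁ ζ₂) (α β : ℝ) :
    ‖((α - β : ℝ) : ℂ) * ζ₁ α - (ζ α - ζ β)‖ ≤ M * (α - β) ^ 2 := by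
  have key := (convex_uIcc α β).norm_image_sub_le_of_norm_hasDerivWithin_le (𝕜 := ℝ)
    (f := fun t : ℝ => ζ t - (t : ℂ) * ζ₁ α) (f' := fun t => ζ₁ t - ζ₁ α) (C := M * |α - β|)
    (fun x _ => by
      have := (H.hasDeriv x).sub ((Complex.ofRealCLM.hasDerivAt (x := x)).mul_const (ζ₁ α))
      exact (this.congr_deriv (by simp)).hasDerivWithinAt)
    (fun x hx => (H.taylor_one_deriv x α).trans (by
      refine mul_le_mul_of_nonneg_left ?_ H.M_pos.le
      rw [abs_sub_comm α β]
      exact Set.abs_sub_left_of_mem_uIcc hx))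
    Set.right_mem_uIcc Set.left_mem_uIcc
  have e : ((α - β : ℝ) : ℂ) * ζ₁ α - (ζ α - ζ β)
      = -((ζ α - (α : ℂ) * ζ₁ α) - (ζ β - (β : ℂ) * ζ₁ α)) := by push_cast; ring
  rw [e, norm_neg]
  refine key.trans (le_of_eq ?_)
  rw [Real.norm_eq_abs, mul_assoc, ← sq, sq_abs]

/-- The mean value inequality is applied twice, first to ζ₁ and then to ζ. The Hölder bound on ζ₂
supplies the extra factor |α - β|^δ, which ultimately makes the differentiated kernel integrable. -/
theorem taylor_two (H : IsChordArc δ M B ζ ζ₁ ζ₂) (α β : ℝ) :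
    ‖(ζ α - ζ β) - ((α - β : ℝ) : ℂ) * ζ₁ α + ((α - β : ℝ) : ℂ) ^ 2 / 2 * ζ₂ α‖
      ≤ M * |α - β| ^ δ * (α - β) ^ 2 := by
  have hM := H.M_pos.le
  have step : ∀ x ∈ Set.uIcc α β, ‖ζ₁ x - ζ₁ α - ((x - α : ℝ) : ℂ) * ζ₂ α‖
      ≤ M * |α - β| ^ δ * |α - β| := by
    intro x hx
    have key := (convex_uIcc α β).norm_image_sub_le_of_norm_hasDerivWithin_le (𝕜 := ℝ)
      (f := fun t : ℝ => ζ₁ t - (t : ℂ) * ζ₂ α) (f' := fun t => ζ₂ t - ζ₂ α)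
      (C := M * |α - β| ^ δ)
      (fun x _ => by
        have := (H.hasDeriv₁ x).sub ((Complex.ofRealCLM.hasDerivAt (x := x)).mul_const (ζ₂ α))
        exact (this.congr_deriv (by simp)).hasDerivWithinAt)
      (fun x hx => (H.holder x α).trans (by
        have := Set.abs_sub_left_of_mem_uIcc hx
        rw [abs_sub_comm β α] at this
        have := H.delta_pos
        gcongr))
      Set.left_mem_uIcc hx
    have e : ζ₁ x - ζ₁ α - ((x - α : ℝ) : ℂ) * ζ₂ α
        = (ζ₁ x - (x : ℂ) * ζ₂ α) - (ζ₁ α - (α : ℂ) * ζ₂ α) := by push_cast; ring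
    rw [e]
    refine key.trans ?_
    gcongr
    rw [Real.norm_eq_abs, abs_sub_comm α β]
    exact Set.abs_sub_left_of_mem_uIcc hx
  have key := (convex_uIcc α β).norm_image_sub_le_of_norm_hasDerivWithin_le (𝕜 := ℝ)
    (f := fun t : ℝ => ζ t - (t : ℂ) * ζ₁ α - ((t - α : ℝ) : ℂ) ^ 2 / 2 * ζ₂ α)
    (f' := fun t => ζ₁ t - ζ₁ α - ((t - α : ℝ) : ℂ) * ζ₂ α) (C := M * |α - β| ^ δ * |α - β|)
    (fun x _ => by
      have h1 : HasDerivAt (fun t : ℝ => ((t - α : ℝ) : ℂ)) 1 x := by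
        simpa using ((hasDerivAt_id x).sub_const α).ofReal_comp
      have := ((H.hasDeriv x).sub ((Complex.ofRealCLM.hasDerivAt (x := x)).mul_const (ζ₁ α))).sub
        (((h1.pow 2).div_const 2).mul_const (ζ₂ α))
      refine (this.congr_deriv ?_).hasDerivWithinAt
      simp)
    step Set.right_mem_uIcc Set.left_mem_uIcc
  have e : (ζ α - ζ β) - ((α - β : ℝ) : ℂ) * ζ₁ α + ((α - β : ℝ) : ℂ) ^ 2 / 2 * ζ₂ α
      = (ζ α - (α : ℂ) * ζ₁ α - ((α - α : ℝ) : ℂ) ^ 2 / 2 * ζ₂ α) -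
        (ζ β - (β : ℂ) * ζ₁ α - ((β - α : ℝ) : ℂ) ^ 2 / 2 * ζ₂ α) := by push_cast; ring
  rw [e]
  refine key.trans (le_of_eq ?_)
  rw [Real.norm_eq_abs, mul_assoc, mul_assoc, ← sq, sq_abs, mul_assoc]

theorem sin_ne_zero (H : IsChordArc δ M B ζ ζ₁ ζ₂) {α β : ℝ} (h : |α - β| ≤ π) (h0 : α ≠ β) :
    Complex.sin ((ζ α - ζ β) / 2) ≠ 0 := by
  intro hs
  have := H.arc_sin α β h
  rw [hs] at this
  have h1 : 0 < (α - β) ^ 2 := by have := sub_ne_zero.2 h0; positivity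
  simp only [norm_zero, ne_eq, OfNat.ofNat_ne_zero, not_false_eq_true, zero_pow, mul_zero] at this
  linarith

theorem norm_inv_sin_sq_le (H : IsChordArc δ M B ζ ζ₁ ζ₂) {α β : ℝ} (h : |α - β| ≤ π)
    (h0 : α ≠ β) :
    ‖1 / Complex.sin ((ζ α - ζ β) / 2) ^ 2‖ ≤ B / (α - β) ^ 2 := by
  have h1 : 0 < (α - β) ^ 2 := by have := sub_ne_zero.2 h0; positivity
  have hs := norm_pos_iff.2 (H.sin_ne_zero h h0)
  rw [norm_div, norm_one, norm_pow, div_le_div_iff₀ (by positivity) h1, one_mul]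
  exact H.arc_sin α β h

theorem norm_cot_le (H : IsChordArc δ M B ζ ζ₁ ζ₂) {α β : ℝ} (h : |α - β| ≤ π)
    (h0 : α ≠ β) :
    ‖Complex.cos ((ζ α - ζ β) / 2) / Complex.sin ((ζ α - ζ β) / 2)‖ ≤ B / |α - β| := by
  have h1 : 0 < |α - β| := abs_pos.2 (sub_ne_zero.2 h0)
  have hs := norm_pos_iff.2 (H.sin_ne_zero h h0)
  have hB := H.one_le_B
  rw [norm_div, div_le_div_iff₀ hs h1]
  refine abs_le_of_sq_le_sq' ?_ (by positivity) |>.2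
  have := H.arc_cos α β h
  rw [mul_pow, mul_pow, sq_abs, mul_comm]
  refine this.trans ?_
  gcongr
  nlinarith

theorem norm_near (H : IsChordArc δ M B ζ ζ₁ ζ₂) {α β : ℝ} (h : M * |α - β| ≤ 1) :
    ‖(ζ α - ζ β) / 2‖ ≤ 1 / 2 := by
  rw [norm_div, Complex.norm_two]
  linarith [H.taylor_zero α β]

theorem abs_le_pi_of_near (H : IsChordArc δ M B ζ ζ₁ ζ₂) {α β : ℝ} (h : M * |α - β| ≤ 1) :
    |α - β| ≤ π := by
  have := H.one_le_M
  have := abs_nonneg (α - β)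
  nlinarith [Real.pi_gt_three]

/-- Squaring `abs_sub_le_of_near` would cost B²; this squared form keeps the final estimate linear
in B. -/
theorem sub_sq_le_of_near (H : IsChordArc δ M B ζ ζ₁ ζ₂) {α β : ℝ} (h : M * |α - β| ≤ 1) :
    (α - β) ^ 2 ≤ B * ‖ζ α - ζ β‖ ^ 2 := by
  refine (H.arc_sin α β (H.abs_le_pi_of_near h)).trans ?_
  have := (norm_sin_bounds (H.norm_near h)).2
  rw [norm_div, Complex.norm_two] at this
  have := H.B_pos.le
  gcongr
  linarith

theorem abs_sub_le_of_near (H : IsChordArc δ M B ζ ζ₁ ζ₂) {α β : ℝ} (h : M * |α - β| ≤ 1) :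
    |α - β| ≤ B * ‖ζ α - ζ β‖ := by
  have hB := H.one_le_B
  refine abs_le_of_sq_le_sq ?_ (by positivity)
  refine (H.sub_sq_le_of_near h).trans ?_
  rw [mul_pow]
  gcongr
  nlinarith

theorem sub_ne_zero_of_near (H : IsChordArc δ M B ζ ζ₁ ζ₂) {α β : ℝ} (h : M * |α - β| ≤ 1)
    (h0 : α ≠ β) : ζ α - ζ β ≠ 0 := by
  intro hz
  have := H.abs_sub_le_of_near h
  rw [hz] at this
  have h1 : 0 < |α - β| := abs_pos.2 (sub_ne_zero.2 h0)
  simp at this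
  exact h0 (by linarith)

/-- Near the diagonal, the complex kernel is `2 / (α - β)` up to a bounded error. -/
theorem norm_cotKernel_sub_le_of_near (H : IsChordArc δ M B ζ ζ₁ ζ₂) {α β : ℝ}
    (h : M * |α - β| ≤ 1) (h0 : α ≠ β) :
    ‖cotKernel ζ ζ₁ α β - 2 / ((α - β : ℝ) : ℂ)‖ ≤ 4 * B * M := by
  have hB := H.one_le_B
  have hM := H.one_le_M
  have hw := H.sub_ne_zero_of_near h h0
  have hn := H.norm_near h
  have h1 := norm_cot_sub_inv_le hn (div_ne_zero hw two_ne_zero)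
  have hh : ((α - β : ℝ) : ℂ) ≠ 0 := by exact_mod_cast sub_ne_zero.2 h0
  -- Replace cot(w/2) by 2/w, w being the chord; what is left is the first-order Taylor remainder
  -- over (α - β) w.
  have e : cotKernel ζ ζ₁ α β - 2 / ((α - β : ℝ) : ℂ)
      = (Complex.cos ((ζ α - ζ β) / 2) / Complex.sin ((ζ α - ζ β) / 2)
          - 1 / ((ζ α - ζ β) / 2)) * ζ₁ α
        + 2 * (((α - β : ℝ) : ℂ) * ζ₁ α - (ζ α - ζ β)) / (((α - β : ℝ) : ℂ) * (ζ α - ζ β)) := by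
    unfold cotKernel
    generalize Complex.cos ((ζ α - ζ β) / 2) / Complex.sin ((ζ α - ζ β) / 2) = c
    generalize ((α - β : ℝ) : ℂ) = d at *
    generalize ζ α - ζ β = w at *
    field_simp
    ring
  have hwp := norm_pos_iff.2 hw
  have hhp : 0 < |α - β| := abs_pos.2 (sub_ne_zero.2 h0)
  rw [e]
  calc _ ≤ 2 * M + 2 * B * M := by
        refine (norm_add_le _ _).trans (add_le_add ?_ ?_)
        · rw [norm_mul]
          gcongr
          exact H.norm₁ α
        · rw [norm_div, norm_mul, norm_mul, Complex.norm_two, Complex.norm_real, Real.norm_eq_abs,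
            div_le_iff₀ (by positivity)]
          have h2 := H.taylor_one α β
          have h3 := H.abs_sub_le_of_near h
          calc _ ≤ 2 * (M * (α - β) ^ 2) := by gcongr
            _ = 2 * M * |α - β| * |α - β| := by rw [← sq_abs]; ring
            _ ≤ 2 * M * |α - β| * (B * ‖ζ α - ζ β‖) := by gcongr
            _ = _ := by ring
    _ ≤ _ := by nlinarith

/-- Near the diagonal the singular part 2/(α - β) is real and drops out. Away from it, 1/|α - β| ≤ M
and the crude cotangent bound suffices. -/
theorem abs_im_cotKernel_le (H : IsChordArc δ M B ζ ζ₁ ζ₂) {α β : ℝ} (h : |α - β| ≤ π)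
    (h0 : α ≠ β) : |(cotKernel ζ ζ₁ α β).im| ≤ 4 * B * M ^ 2 := by
  have hB := H.one_le_B
  have hM := H.one_le_M
  have hhp : 0 < |α - β| := abs_pos.2 (sub_ne_zero.2 h0)
  rcases le_total (M * |α - β|) 1 with h1 | h1
  · have h2 := (Complex.abs_im_le_norm _).trans (H.norm_cotKernel_sub_le_of_near h1 h0)
    have h3 : (2 / ((α - β : ℝ) : ℂ)).im = 0 := by
      rw [show (2 / ((α - β : ℝ) : ℂ)) = ((2 / (α - β) : ℝ) : ℂ) by push_cast; rfl]
      exact Complex.ofReal_im _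
    rw [Complex.sub_im, h3, sub_zero] at h2
    refine h2.trans ?_
    gcongr
    nlinarith
  · refine (Complex.abs_im_le_norm _).trans ?_
    unfold cotKernel
    rw [norm_mul]
    calc _ ≤ B / |α - β| * M := by
          gcongr
          · exact H.norm_cot_le h h0
          · exact H.norm₁ α
      _ ≤ B * M * M := by
          gcongr
          rw [div_le_iff₀ hhp]
          nlinarith
      _ ≤ _ := by nlinarith [mul_pos H.B_pos (mul_pos H.M_pos H.M_pos)]

/-- Same dichotomy, with singular part -2/(α - β)², again real. The fourth power of M is forced only
by the far region, where 1/(α - β)² is traded for M² next to ζ₁². -/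
theorem abs_im_cotKernelDeriv_le (H : IsChordArc δ M B ζ ζ₁ ζ₂) {α β : ℝ} (h : |α - β| ≤ π)
    (h0 : α ≠ β) :
    |(cotKernelDeriv ζ ζ₁ ζ₂ α β).im| ≤ 6 * B * M ^ 4 * (1 + |α - β| ^ (δ - 1)) := by
  have hB := H.one_le_B
  have hM := H.one_le_M
  have hhp : 0 < |α - β| := abs_pos.2 (sub_ne_zero.2 h0)
  have hpw : 0 < |α - β| ^ (δ - 1) := Real.rpow_pos_of_pos hhp _
  have hM2 : M ≤ M ^ 2 := by nlinarith
  have hM4 : M ^ 2 ≤ M ^ 4 := pow_le_pow_right₀ hM (by norm_num)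
  rcases le_total (M * |α - β|) 1 with h1 | h1
  · have hw := H.sub_ne_zero_of_near h1 h0
    have hn := H.norm_near h1
    have b1 := norm_cot_sub_inv_le hn (div_ne_zero hw two_ne_zero)
    have b2 := norm_inv_sin_sq_sub_le hn (div_ne_zero hw two_ne_zero)
    have hh : ((α - β : ℝ) : ℂ) ≠ 0 := by exact_mod_cast sub_ne_zero.2 h0
    have t1 := H.taylor_one α β
    have t2 := H.taylor_two α β
    have s1 := H.abs_sub_le_of_near h1
    have s2 := H.sub_sq_le_of_near h1
    have hwp := norm_pos_iff.2 hw
    set E := (ζ α - ζ β) - ((α - β : ℝ) : ℂ) * ζ₁ α + ((α - β : ℝ) : ℂ) ^ 2 / 2 * ζ₂ α with hE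
    set G := ((α - β : ℝ) : ℂ) * ζ₁ α - (ζ α - ζ β) with hG
    set r1 := Complex.cos ((ζ α - ζ β) / 2) / Complex.sin ((ζ α - ζ β) / 2)
      - 1 / ((ζ α - ζ β) / 2) with hr1
    set r2 := 1 / Complex.sin ((ζ α - ζ β) / 2) ^ 2 - 1 / ((ζ α - ζ β) / 2) ^ 2 with hr2
    -- With h = α - β and w the chord, substituting 1/sin² → 4/w² and cot → 2/w costs the bounded
    -- errors `r2`, `r1`. The rest is an exact identity in the Taylor remainders: E = O(h^(2+δ))
    -- gives O(h^(δ-1)), and G² = O(h⁴) gives O(1).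
    have e : cotKernelDeriv ζ ζ₁ ζ₂ α β + 2 / ((α - β : ℝ) : ℂ) ^ 2
        = (-(ζ₁ α ^ 2 / 2 * r2) + r1 * ζ₂ α)
          + (4 * E / (((α - β : ℝ) : ℂ) ^ 2 * (ζ α - ζ β))
            - 2 * G ^ 2 / (((α - β : ℝ) : ℂ) ^ 2 * (ζ α - ζ β) ^ 2)) := by
      unfold cotKernelDeriv
      rw [hr1, hr2, hE, hG]
      generalize Complex.cos ((ζ α - ζ β) / 2) / Complex.sin ((ζ α - ζ β) / 2) = c
      generalize Complex.sin ((ζ α - ζ β) / 2) ^ 2 = s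
      generalize ((α - β : ℝ) : ℂ) = d at *
      generalize ζ α - ζ β = w at *
      have : ∀ t : ℂ, -(ζ₁ α ^ 2 / 2 * t) + c * ζ₂ α + 2 / d ^ 2
        = -(ζ₁ α ^ 2 / 2 * (t - 1 / (w / 2) ^ 2)) + (c - 1 / (w / 2)) * ζ₂ α
        + (4 * (w - d * ζ₁ α + d ^ 2 / 2 * ζ₂ α) / (d ^ 2 * w)
          - 2 * (d * ζ₁ α - w) ^ 2 / (d ^ 2 * w ^ 2)) := by
        intro t
        field_simp
        ring
      exact this _
    have h3 : (2 / ((α - β : ℝ) : ℂ) ^ 2).im = 0 := by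
      rw [show (2 / ((α - β : ℝ) : ℂ) ^ 2) = ((2 / (α - β) ^ 2 : ℝ) : ℂ) by push_cast; rfl]
      exact Complex.ofReal_im _
    have h4 : (cotKernelDeriv ζ ζ₁ ζ₂ α β).im
        = (cotKernelDeriv ζ ζ₁ ζ₂ α β + 2 / ((α - β : ℝ) : ℂ) ^ 2).im := by
      rw [Complex.add_im, h3, add_zero]
    rw [h4, e]
    refine (Complex.abs_im_le_norm _).trans ?_
    have c1 : ‖-(ζ₁ α ^ 2 / 2 * r2) + r1 * ζ₂ α‖ ≤ M ^ 2 / 2 * 3 + 2 * M := by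
      refine (norm_add_le _ _).trans (add_le_add ?_ ?_)
      · rw [norm_neg, norm_mul, norm_div, norm_pow, Complex.norm_two]
        gcongr
        exact H.norm₁ α
      · rw [norm_mul]
        gcongr
        exact H.norm₂ α
    have c2 : ‖4 * E / (((α - β : ℝ) : ℂ) ^ 2 * (ζ α - ζ β))‖
        ≤ 4 * B * M * |α - β| ^ (δ - 1) := by
      rw [norm_div, norm_mul, norm_mul, norm_pow, Complex.norm_real, Real.norm_eq_abs, sq_abs,
        div_le_iff₀ (by have := sub_ne_zero.2 h0; positivity), Real.rpow_sub_one hhp.ne',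
        show ‖(4 : ℂ)‖ = 4 by simp]
      calc 4 * ‖E‖ ≤ 4 * (M * |α - β| ^ δ * (α - β) ^ 2) := by gcongr
        _ = 4 * M * (|α - β| ^ δ / |α - β|) * (α - β) ^ 2 * |α - β| := by field_simp
        _ ≤ 4 * M * (|α - β| ^ δ / |α - β|) * (α - β) ^ 2 * (B * ‖ζ α - ζ β‖) := by
          have := Real.rpow_nonneg hhp.le δ
          gcongr
        _ = _ := by ring
    have c3 : ‖2 * G ^ 2 / (((α - β : ℝ) : ℂ) ^ 2 * (ζ α - ζ β) ^ 2)‖ ≤ 2 * B * M ^ 2 := by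
      rw [norm_div, norm_mul, norm_mul, norm_pow, norm_pow, norm_pow, Complex.norm_real,
        Real.norm_eq_abs, sq_abs,
        div_le_iff₀ (by have := sub_ne_zero.2 h0; positivity), Complex.norm_two]
      calc 2 * ‖G‖ ^ 2 ≤ 2 * (M * (α - β) ^ 2) ^ 2 := by gcongr
        _ = 2 * M ^ 2 * (α - β) ^ 2 * (α - β) ^ 2 := by ring
        _ ≤ 2 * M ^ 2 * (α - β) ^ 2 * (B * ‖ζ α - ζ β‖ ^ 2) := by gcongr
        _ = _ := by ring
    calc _ ≤ (M ^ 2 / 2 * 3 + 2 * M) + (4 * B * M * |α - β| ^ (δ - 1) + 2 * B * M ^ 2) :=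
          (norm_add_le _ _).trans (add_le_add c1 ((norm_sub_le _ _).trans (add_le_add c2 c3)))
      _ ≤ (M ^ 4 / 2 * 3 + 2 * M ^ 4) + (4 * B * M ^ 4 * |α - β| ^ (δ - 1) + 2 * B * M ^ 4) := by
          gcongr <;> linarith
      _ ≤ _ := by
          have : 0 < M ^ 4 := by have := H.M_pos; positivity
          have : M ^ 4 ≤ B * M ^ 4 := by nlinarith
          have : 0 ≤ B * M ^ 4 * |α - β| ^ (δ - 1) := by have := H.B_pos; positivity
          nlinarith
  · refine (Complex.abs_im_le_norm _).trans ?_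
    have b1 := H.norm_cot_le h h0
    have b2 := H.norm_inv_sin_sq_le h h0
    have q1 : B / |α - β| ≤ B * M := by
      rw [div_le_iff₀ hhp]; nlinarith
    have q2 : B / (α - β) ^ 2 ≤ B * M ^ 2 := by
      rw [div_le_iff₀ (by have := sub_ne_zero.2 h0; positivity), mul_assoc, ← sq_abs (α - β),
        ← mul_pow]
      have : 1 ≤ (M * |α - β|) ^ 2 := one_le_pow₀ h1
      nlinarith
    calc ‖cotKernelDeriv ζ ζ₁ ζ₂ α β‖ ≤ M ^ 2 / 2 * (B * M ^ 2) + B * M * M := by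
          refine (norm_add_le _ _).trans (add_le_add ?_ ?_)
          · rw [norm_neg, norm_mul, norm_div, norm_pow, Complex.norm_two]
            have := H.norm₁ α
            gcongr
            exact b2.trans q2
          · rw [norm_mul]
            have := H.norm₂ α
            have := H.M_pos
            gcongr
            exact b1.trans q1
      _ ≤ 6 * B * M ^ 4 * 1 := by
          have : B * M * M ≤ B * M ^ 4 := by
            rw [mul_assoc, ← sq]; gcongr
          nlinarith
      _ ≤ _ := by
          have := H.B_pos; have := H.M_pos
          gcongr; linarith

end IsChordArc

/-! ### Representatives of points of the circle -/

/-- The representative in `(-π, π]` of a point of the circle. -/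
def rep (a : Torus) : ℝ := (AddCircle.measurableEquivIoc (2 * π) (-π) a : ℝ)

theorem measurable_rep : Measurable rep :=
  measurable_subtype_coe.comp (AddCircle.measurableEquivIoc (2 * π) (-π)).measurable

theorem coe_rep (a : Torus) : (rep a : Torus) = a :=
  (AddCircle.equivIoc (2 * π) (-π)).symm_apply_apply a

theorem abs_rep_le (a : Torus) : |rep a| ≤ π := by
  have h : rep a ∈ Set.Ioc (-π) (-π + 2 * π) := (AddCircle.measurableEquivIoc (2 * π) (-π) a).2
  rw [abs_le]
  constructor <;> linarith [h.1, h.2]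

theorem exists_rep_coe (x : ℝ) : ∃ n : ℤ, x = rep (x : Torus) + n * (2 * π) := by
  have h := coe_rep (x : Torus)
  have h1 : ((x - rep (x : Torus) : ℝ) : Torus) = 0 := by
    rw [AddCircle.coe_sub, h, sub_self]
  obtain ⟨n, hn⟩ := (AddCircle.coe_eq_zero_iff _).1 h1
  refine ⟨n, ?_⟩
  rw [zsmul_eq_mul] at hn
  linarith

theorem _root_.Function.Periodic.apply_rep_coe {E : Type*} {f : ℝ → E}
    (hf : Function.Periodic f (2 * π)) (x : ℝ) : f (rep (x : Torus)) = f x := by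
  obtain ⟨n, hn⟩ := exists_rep_coe x
  conv_rhs => rw [hn]
  exact (hf.int_mul n _).symm

theorem norm_torus_coe {x : ℝ} (h : |x| ≤ π) : ‖(x : Torus)‖ = |x| := by
  have hp := Real.two_pi_pos
  rw [AddCircle.norm_coe_eq_abs_iff _ hp.ne', abs_of_pos hp]
  linarith

theorem integral_torus_eq {E : Type*} [NormedAddCommGroup E] [NormedSpace ℝ E]
    (f : Torus → E) (t : ℝ) : ∫ a, f a = ∫ x in t..t + 2 * π, f (x : Torus) :=
  (AddCircle.intervalIntegral_preimage (2 * π) t f).symm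

theorem exists_bound_comp_rep {f : ℝ → ℝ} (hf : Continuous f) : ∃ c, ∀ a, ‖f (rep a)‖ ≤ c := by
  obtain ⟨c, hc⟩ := isCompact_Icc.exists_bound_of_continuousOn (s := Set.Icc (-π) π)
    hf.continuousOn
  exact ⟨c, fun a => hc _ (abs_le.1 (abs_rep_le a))⟩

theorem _root_.Function.Periodic.deriv_periodic {f : ℝ → ℝ} {c : ℝ}
    (hf : Function.Periodic f c) : Function.Periodic (deriv f) c := by
  intro x
  rw [← deriv_comp_add_const, funext hf]

attribute [irreducible] rep

/-! ### Integral operators on the circle with a convolution majorant -/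

/-- The integral operator with kernel `k`. -/
def kernelOp (k : Torus → Torus → ℝ) (u : Torus → ℝ) (a : Torus) : ℝ := ∫ b, k a b * u b

/-- `k` is a measurable kernel dominated by the convolution kernel `κ`. -/
structure IsDominated (k : Torus → Torus → ℝ) (κ : Torus → ℝ≥0∞) : Prop where
  meas : Measurable (Function.uncurry k)
  meas_weight : Measurable κ
  finite : ∫⁻ a, κ a ≠ ⊤
  le : ∀ a b, ‖k a b‖ₑ ≤ κ (a - b)

/-- Cauchy-Schwarz for the splitting w U = w^(1/2) · (w^(1/2) U). -/
theorem lintegral_mul_sq_le {X : Type*} [MeasurableSpace X] {μ : Measure X} {w U : X → ℝ≥0∞}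
    (hw : Measurable w) (hU : Measurable U) :
    (∫⁻ x, w x * U x ∂μ) ^ 2 ≤ (∫⁻ x, w x ∂μ) * ∫⁻ x, w x * U x ^ 2 ∂μ := by
  have h := ENNReal.lintegral_mul_le_Lp_mul_Lq μ Real.HolderConjugate.two_two
    (f := fun x => w x ^ (1 / 2 : ℝ)) (g := fun x => w x ^ (1 / 2 : ℝ) * U x)
    (by fun_prop) (by fun_prop)
  have e1 : ∀ x, w x ^ (1 / 2 : ℝ) * w x ^ (1 / 2 : ℝ) = w x := by
    intro x
    rw [← ENNReal.rpow_add_of_nonneg _ _ (by norm_num) (by norm_num)]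
    norm_num
  have e2 : ∀ x : ℝ≥0∞, (x ^ (1 / 2 : ℝ)) ^ (2 : ℝ) = x := by
    intro x
    rw [← ENNReal.rpow_mul]
    norm_num
  simp only [Pi.mul_apply, ← mul_assoc, e1, ENNReal.mul_rpow_of_nonneg _ _ (zero_le_two (α := ℝ)),
    e2] at h
  calc _ ≤ ((∫⁻ x, w x ∂μ) ^ (1 / 2 : ℝ) * (∫⁻ x, w x * U x ^ (2 : ℝ) ∂μ) ^ (1 / 2 : ℝ)) ^ 2 := by
        gcongr
    _ = _ := by
        rw [← ENNReal.rpow_natCast, Nat.cast_ofNat,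
          ENNReal.mul_rpow_of_nonneg _ _ (zero_le_two (α := ℝ)), e2, e2]
        simp

namespace IsDominated

variable {k : Torus → Torus → ℝ} {κ : Torus → ℝ≥0∞}

/-- Young's inequality L¹ * L² → L²: weighted Cauchy-Schwarz, Tonelli, and translation invariance in
each variable. -/
theorem lintegral_conv_sq_le (hκ : Measurable κ) {U : Torus → ℝ≥0∞} (hU : Measurable U) :
    ∫⁻ a, (∫⁻ b, κ (a - b) * U b) ^ 2 ≤ (∫⁻ a, κ a) ^ 2 * ∫⁻ b, U b ^ 2 := by
  calc ∫⁻ a, (∫⁻ b, κ (a - b) * U b) ^ 2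
      ≤ ∫⁻ a, (∫⁻ b, κ b) * ∫⁻ b, κ (a - b) * U b ^ 2 := by
        refine lintegral_mono fun a => ?_
        refine (lintegral_mul_sq_le (by fun_prop) hU).trans (le_of_eq ?_)
        rw [lintegral_sub_left_eq_self κ a]
    _ = (∫⁻ b, κ b) * ∫⁻ a, ∫⁻ b, κ (a - b) * U b ^ 2 := by
        rw [lintegral_const_mul]
        exact Measurable.lintegral_prod_right' (f := fun p : Torus × Torus =>
          κ (p.1 - p.2) * U p.2 ^ 2) (by fun_prop)
    _ = (∫⁻ b, κ b) * ∫⁻ b, ∫⁻ a, κ (a - b) * U b ^ 2 := by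
        rw [lintegral_lintegral_swap (by fun_prop)]
    _ = _ := by
        have : ∀ b, ∫⁻ a, κ (a - b) * U b ^ 2 = (∫⁻ a, κ a) * U b ^ 2 := by
          intro b
          rw [lintegral_mul_const _ (by fun_prop), lintegral_sub_right_eq_self κ b]
        simp_rw [this]
        rw [lintegral_const_mul _ (by fun_prop), ← mul_assoc, sq]

theorem lintegral_sq_lt_top (u : L2) : ∫⁻ a, ‖u a‖ₑ ^ 2 < ⊤ := by
  have h := (Lp.memLp u).2
  rw [eLpNorm_lt_top_iff_lintegral_rpow_enorm_lt_top (by norm_num) (by norm_num)] at h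
  simpa using h

theorem enorm_mul_le (h : IsDominated k κ) (u : Torus → ℝ) (a b : Torus) :
    ‖k a b * u b‖ₑ ≤ κ (a - b) * ‖u b‖ₑ := by
  rw [enorm_mul]
  gcongr
  exact h.le a b

theorem measurable_mul (h : IsDominated k κ) (u : L2) :
    Measurable fun p : Torus × Torus => k p.1 p.2 * u p.2 :=
  h.meas.mul ((Lp.stronglyMeasurable u).measurable.comp measurable_snd)

theorem ae_integrable (h : IsDominated k κ) (u : L2) :
    ∀ᵐ a, Integrable fun b => k a b * u b := by
  have hκ := h.meas_weight
  have hu : Measurable u := (Lp.stronglyMeasurable u).measurable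
  have h1 := lintegral_conv_sq_le hκ (U := fun b => ‖u b‖ₑ) (by fun_prop)
  have h2 : ∫⁻ a, (∫⁻ b, κ (a - b) * ‖u b‖ₑ) ^ 2 ≠ ⊤ := by
    refine (h1.trans_lt ?_).ne
    exact ENNReal.mul_lt_top (ENNReal.pow_lt_top (lt_top_iff_ne_top.2 h.finite))
      (lintegral_sq_lt_top u)
  have h3 : Measurable fun a => (∫⁻ b, κ (a - b) * ‖u b‖ₑ) ^ 2 :=
    (Measurable.lintegral_prod_right' (f := fun p : Torus × Torus =>
          κ (p.1 - p.2) * ‖u p.2‖ₑ) (by fun_prop)).pow_const 2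
  filter_upwards [ae_lt_top h3 h2] with a ha
  refine ⟨((h.measurable_mul u).comp measurable_prodMk_left).aestronglyMeasurable, ?_⟩
  refine (lintegral_mono fun b => h.enorm_mul_le u a b).trans_lt ?_
  by_contra hc
  rw [not_lt, top_le_iff] at hc
  rw [hc] at ha
  simp at ha

theorem integrable_prod (h : IsDominated k κ) (u : L2) :
    Integrable (fun p : Torus × Torus => k p.1 p.2 * u p.2) (volume.prod volume) := by
  have hκ := h.meas_weight
  have hu : Measurable u := (Lp.stronglyMeasurable u).measurable
  refine ⟨(h.measurable_mul u).aestronglyMeasurable, ?_⟩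
  rw [hasFiniteIntegral_iff_enorm, lintegral_prod_symm' _ (h.measurable_mul u).enorm]
  calc _ ≤ ∫⁻ b, ∫⁻ a, κ (a - b) * ‖u b‖ₑ :=
        lintegral_mono fun b => lintegral_mono fun a => h.enorm_mul_le u a b
    _ = (∫⁻ a, κ a) * ∫⁻ b, ‖u b‖ₑ := by
        rw [← lintegral_const_mul _ (by fun_prop)]
        refine lintegral_congr fun b => ?_
        rw [lintegral_mul_const _ (by fun_prop), lintegral_sub_right_eq_self κ b]
    _ < ⊤ := by
        refine ENNReal.mul_lt_top (lt_top_iff_ne_top.2 h.finite) ?_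
        exact ((Lp.memLp u).integrable (by norm_num)).2

theorem stronglyMeasurable_kernelOp (h : IsDominated k κ) (u : L2) :
    StronglyMeasurable (kernelOp k u) :=
  (h.measurable_mul u).stronglyMeasurable.integral_prod_right

theorem eLpNorm_kernelOp_le (h : IsDominated k κ) (u : L2) :
    eLpNorm (kernelOp k u) 2 volume ≤ (∫⁻ a, κ a) * eLpNorm u 2 volume := by
  have hκ := h.meas_weight
  have hu : Measurable u := (Lp.stronglyMeasurable u).measurable
  rw [eLpNorm_eq_lintegral_rpow_enorm_toReal (by norm_num) (by norm_num),
    eLpNorm_eq_lintegral_rpow_enorm_toReal (by norm_num) (by norm_num)]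
  simp only [ENNReal.toReal_ofNat, ENNReal.rpow_ofNat]
  have h1 : ∫⁻ a, ‖kernelOp k u a‖ₑ ^ 2 ≤ (∫⁻ a, κ a) ^ 2 * ∫⁻ b, ‖u b‖ₑ ^ 2 := by
    refine le_trans ?_ (lintegral_conv_sq_le hκ (U := fun b => ‖u b‖ₑ) (by fun_prop))
    refine lintegral_mono fun a => ?_
    gcongr
    refine (enorm_integral_le_lintegral_enorm _).trans ?_
    exact lintegral_mono fun b => h.enorm_mul_le u a b
  calc _ ≤ ((∫⁻ a, κ a) ^ 2 * ∫⁻ b, ‖u b‖ₑ ^ 2) ^ (1 / 2 : ℝ) := by gcongr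
    _ = _ := by
      rw [ENNReal.mul_rpow_of_nonneg _ _ (by norm_num), ← ENNReal.rpow_natCast,
        ← ENNReal.rpow_mul]
      norm_num

theorem memLp_kernelOp (h : IsDominated k κ) (u : L2) : MemLp (kernelOp k u) 2 volume :=
  ⟨(h.stronglyMeasurable_kernelOp u).aestronglyMeasurable,
    (h.eLpNorm_kernelOp_le u).trans_lt
      (ENNReal.mul_lt_top (lt_top_iff_ne_top.2 h.finite) (Lp.memLp u).2)⟩

/-- The integral operator with a dominated kernel, as a bounded operator on `L²(𝕋)`. -/
def toCLM (h : IsDominated k κ) : L2 →L[ℝ] L2 :=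
  LinearMap.mkContinuous
    { toFun := fun u => (h.memLp_kernelOp u).toLp
      map_add' := fun u v => by
        refine Lp.ext ?_
        filter_upwards [(h.memLp_kernelOp (u + v)).coeFn_toLp, (h.memLp_kernelOp u).coeFn_toLp,
          (h.memLp_kernelOp v).coeFn_toLp,
          Lp.coeFn_add (h.memLp_kernelOp u).toLp (h.memLp_kernelOp v).toLp,
          h.ae_integrable u, h.ae_integrable v] with a h1 h2 h3 h4 h5 h6
        rw [h1, h4, Pi.add_apply, h2, h3]
        unfold kernelOp
        rw [← integral_add h5 h6]
        refine integral_congr_ae ?_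
        filter_upwards [Lp.coeFn_add u v] with b hb
        rw [hb, Pi.add_apply]
        ring
      map_smul' := fun c u => by
        refine Lp.ext ?_
        filter_upwards [(h.memLp_kernelOp (c • u)).coeFn_toLp, (h.memLp_kernelOp u).coeFn_toLp,
          Lp.coeFn_smul c (h.memLp_kernelOp u).toLp] with a h1 h2 h4
        rw [h1, RingHom.id_apply, h4, Pi.smul_apply, h2]
        unfold kernelOp
        rw [← integral_smul]
        refine integral_congr_ae ?_
        filter_upwards [Lp.coeFn_smul c u] with b hb
        rw [hb, Pi.smul_apply]
        simp only [smul_eq_mul]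
        ring } (∫⁻ a, κ a).toReal
    fun u => by
      simp only [LinearMap.coe_mk, AddHom.coe_mk]
      rw [Lp.norm_toLp, Lp.norm_def, ← ENNReal.toReal_mul]
      exact ENNReal.toReal_mono (ENNReal.mul_ne_top h.finite (Lp.memLp u).2.ne)
        (h.eLpNorm_kernelOp_le u)

theorem coeFn_toCLM (h : IsDominated k κ) (u : L2) : h.toCLM u =ᵐ[volume] kernelOp k u :=
  (h.memLp_kernelOp u).coeFn_toLp

theorem norm_toCLM_apply_le (h : IsDominated k κ) (u : L2) :
    ‖h.toCLM u‖ ≤ (∫⁻ a, κ a).toReal * ‖u‖ :=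
  (h.toCLM.le_opNorm u).trans (by
    gcongr
    exact LinearMap.mkContinuous_norm_le _ ENNReal.toReal_nonneg _)

/-- Fubini moves the kernel onto the test function, so that a weak derivative of the operator
reduces to one of the kernel in its first variable, for each fixed b. -/
theorem integral_kernelOp_mul (h : IsDominated k κ) (u : L2) {ψ : Torus → ℝ} (hψ : Measurable ψ)
    {c : ℝ} (hc : ∀ a, ‖ψ a‖ ≤ c) :
    ∫ a, kernelOp k u a * ψ a = ∫ b, (∫ a, k a b * ψ a) * u b := by
  have h1 : Integrable (fun p : Torus × Torus => k p.1 p.2 * u p.2 * ψ p.1)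
      (volume.prod volume) :=
    (h.integrable_prod u).mul_bdd (hψ.comp measurable_fst).aestronglyMeasurable
      (Eventually.of_forall fun p => hc p.1)
  have h2 := integral_integral_swap (f := fun a b => k a b * u b * ψ a) h1
  simp only [integral_mul_const] at h2
  unfold kernelOp
  rw [h2]
  refine integral_congr_ae (Eventually.of_forall fun b => ?_)
  simp only
  rw [← integral_mul_const]
  refine integral_congr_ae (Eventually.of_forall fun a => ?_)
  simp only
  ring

/-- Two kernels such that the second is the weak derivative of the first give a bounded operator
from `L²(𝕋)` to `H¹(𝕋)`. -/
theorem exists_toH1 {k k' : Torus → Torus → ℝ} {κ κ' : Torus → ℝ≥0∞}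
    (h : IsDominated k κ) (h' : IsDominated k' κ')
    (hw : ∀ φ : ℝ → ℝ, ContDiff ℝ ∞ φ → Function.Periodic φ (2 * π) → ∀ b : Torus,
      ∫ a, k a b * deriv φ (rep a) = -∫ a, k' a b * φ (rep a)) :
    ∃ A : L2 →L[ℝ] H1, (∀ u : L2, H1.toL2 (A u) =ᵐ[volume] kernelOp k u) ∧
      ‖A‖ ≤ (∫⁻ a, κ a).toReal + (∫⁻ a, κ' a).toReal := by
  have conv : ∀ (k : Torus → Torus → ℝ) (κ : Torus → ℝ≥0∞) (h : IsDominated k κ) (u : L2)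
      (f : ℝ → ℝ), Continuous f → Function.Periodic f (2 * π) →
      ∫ x in (-π)..π, h.toCLM u (x : Torus) * f x
        = ∫ b, (∫ a, k a b * f (rep a)) * u b := by
    intro k κ h u f hf hper
    obtain ⟨c, hc⟩ := exists_bound_comp_rep hf
    rw [integral_congr_torus (h.coeFn_toCLM u),
      ← h.integral_kernelOp_mul u (ψ := fun a => f (rep a)) (hf.measurable.comp measurable_rep) hc,
      integral_torus_eq _ (-π), show -π + 2 * π = π by ring]
    simp only [hper.apply_rep_coe]
  have mem : ∀ u : L2, WithLp.toLp 2 (h.toCLM u, h'.toCLM u) ∈ H1 := by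
    intro u φ hφ hper
    have hper' := hper.deriv_periodic
    have e := hw φ hφ hper
    rw [WithLp.toLp_fst, WithLp.toLp_snd, conv _ _ h u _ (hφ.continuous_deriv (by simp)) hper',
      conv _ _ h' u _ hφ.continuous hper]
    simp_rw [e, neg_mul]
    exact integral_neg _
  let L : L2 →ₗ[ℝ] H1 :=
    { toFun := fun u => ⟨WithLp.toLp 2 (h.toCLM u, h'.toCLM u), mem u⟩
      map_add' := fun u v => by
        apply Subtype.ext
        simp only [map_add, Submodule.coe_add, ← WithLp.toLp_add, Prod.mk_add_mk]
      map_smul' := fun c u => by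
        apply Subtype.ext
        simp only [map_smul, RingHom.id_apply, Submodule.coe_smul, ← WithLp.toLp_smul,
          Prod.smul_mk] }
  refine ⟨L.mkContinuous ((∫⁻ a, κ a).toReal + (∫⁻ a, κ' a).toReal) fun u => ?_, fun u => ?_, ?_⟩
  · change ‖WithLp.toLp 2 (h.toCLM u, h'.toCLM u)‖ ≤ _
    rw [WithLp.prod_norm_eq_of_L2, WithLp.toLp_fst, WithLp.toLp_snd, add_mul]
    have h1 := h.norm_toCLM_apply_le u
    have h2 := h'.norm_toCLM_apply_le u
    have h3 := norm_nonneg (h.toCLM u)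
    have h4 := norm_nonneg (h'.toCLM u)
    refine (Real.sqrt_le_sqrt (y := (‖h.toCLM u‖ + ‖h'.toCLM u‖) ^ 2) (by nlinarith)).trans ?_
    rw [Real.sqrt_sq (by positivity)]
    exact add_le_add h1 h2
  · exact h.coeFn_toCLM u
  · exact LinearMap.mkContinuous_norm_le _ (by positivity) _

end IsDominated

/-! ### The weakly singular weight -/

theorem intervalIntegrable_abs_rpow {r : ℝ} (hr : -1 < r) :
    IntervalIntegrable (fun x : ℝ => |x| ^ r) volume (-π) π := by
  have h1 : IntervalIntegrable (fun x : ℝ => |x| ^ r) volume 0 π := by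
    refine (intervalIntegral.intervalIntegrable_rpow' hr).congr ?_
    intro x hx
    rw [Set.uIoc_of_le Real.pi_pos.le] at hx
    simp only [abs_of_pos hx.1]
  have h2 : IntervalIntegrable (fun x : ℝ => |x| ^ r) volume (-π) 0 := by
    have h3 := (IntervalIntegrable.iff_comp_neg (by simp)).1 h1
    simp only [abs_neg, neg_zero] at h3
    exact h3.symm
  exact h2.trans h1

/-- The weight `1 + ‖a‖^{δ-1}` on the circle. -/
def weight (δ : ℝ) (a : Torus) : ℝ≥0∞ := ENNReal.ofReal (1 + ‖a‖ ^ (δ - 1))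

theorem measurable_weight (δ : ℝ) : Measurable (weight δ) := by
  unfold weight
  fun_prop

theorem lintegral_weight_ne_top {δ : ℝ} (hδ : 0 < δ) : ∫⁻ a, weight δ a ≠ ⊤ := by
  rw [← AddCircle.lintegral_preimage (2 * π) (-π), show -π + 2 * π = π by ring]
  have h1 : IntegrableOn (fun x : ℝ => 1 + |x| ^ (δ - 1)) (Set.Ioc (-π) π) :=
    (intervalIntegrable_iff_integrableOn_Ioc_of_le (by linarith [Real.pi_pos])).1
      (intervalIntegrable_const.add (intervalIntegrable_abs_rpow (by linarith)))
  refine ne_of_lt (lt_of_eq_of_lt ?_ h1.2)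
  refine setLIntegral_congr_fun measurableSet_Ioc fun x hx => ?_
  have hx' : |x| ≤ π := abs_le.2 ⟨hx.1.le, hx.2⟩
  simp only [weight]
  rw [norm_torus_coe hx', Real.enorm_of_nonneg (by positivity)]

namespace IsDominated

theorem of_bound {k : Torus → Torus → ℝ} (hk : Measurable (Function.uncurry k)) {δ c : ℝ}
    (hδ : 0 < δ) (h : ∀ a b, |k a b| ≤ c * (1 + ‖a - b‖ ^ (δ - 1))) :
    IsDominated k (fun a => ENNReal.ofReal c * weight δ a) where
  meas := hk
  meas_weight := (measurable_weight δ).const_mul _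
  finite := by
    rw [lintegral_const_mul _ (measurable_weight δ)]
    exact ENNReal.mul_ne_top ENNReal.ofReal_ne_top (lintegral_weight_ne_top hδ)
  le := fun a b => by
    rw [weight, ← ENNReal.ofReal_mul' (by positivity), ← ofReal_norm]
    exact ENNReal.ofReal_le_ofReal (h a b)

theorem integrable_left {k : Torus → Torus → ℝ} {κ : Torus → ℝ≥0∞} (h : IsDominated k κ)
    {ψ : Torus → ℝ} (hψ : Measurable ψ) {c : ℝ} (hc : ∀ a, ‖ψ a‖ ≤ c) (b : Torus) :
    Integrable fun a => k a b * ψ a := by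
  have h1 : Integrable fun a => k a b := by
    refine ⟨(h.meas.comp measurable_prodMk_right).aestronglyMeasurable, ?_⟩
    refine (lintegral_mono fun a => h.le a b).trans_lt ?_
    rw [lintegral_sub_right_eq_self κ b]
    exact lt_top_iff_ne_top.2 h.finite
  exact h1.mul_bdd hψ.aestronglyMeasurable (Eventually.of_forall hc)

end IsDominated

/-! ### The kernels on the circle and integration by parts across the diagonal. -/

namespace IsChordArc

variable {δ M B : ℝ} {ζ ζ₁ ζ₂ : ℝ → ℂ}

theorem continuous (H : IsChordArc δ M B ζ ζ₁ ζ₂) : Continuous ζ :=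
  continuous_iff_continuousAt.2 fun x => (H.hasDeriv x).continuousAt

theorem continuous₁ (H : IsChordArc δ M B ζ ζ₁ ζ₂) : Continuous ζ₁ :=
  continuous_iff_continuousAt.2 fun x => (H.hasDeriv₁ x).continuousAt

theorem half_left (H : IsChordArc δ M B ζ ζ₁ ζ₂) (α β : ℝ) :
    (ζ (α + 2 * π) - ζ β) / 2 = (ζ α - ζ β) / 2 + π := by
  rw [H.per]; ring

theorem half_right (H : IsChordArc δ M B ζ ζ₁ ζ₂) (α β : ℝ) :
    (ζ α - ζ (β + 2 * π)) / 2 = (ζ α - ζ β) / 2 - π := by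
  rw [H.per]; ring

theorem cotKernel_periodic_left (H : IsChordArc δ M B ζ ζ₁ ζ₂) (β : ℝ) :
    Function.Periodic (fun α => cotKernel ζ ζ₁ α β) (2 * π) := by
  intro α
  simp only [cotKernel, H.half_left, Complex.cos_add_pi, Complex.sin_add_pi, H.per₁, neg_div_neg_eq]

theorem cotKernel_periodic_right (H : IsChordArc δ M B ζ ζ₁ ζ₂) (α : ℝ) :
    Function.Periodic (fun β => cotKernel ζ ζ₁ α β) (2 * π) := by
  intro β
  simp only [cotKernel, H.half_right, Complex.cos_sub_pi, Complex.sin_sub_pi, neg_div_neg_eq]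

theorem cotKernelDeriv_periodic_left (H : IsChordArc δ M B ζ ζ₁ ζ₂) (β : ℝ) :
    Function.Periodic (fun α => cotKernelDeriv ζ ζ₁ ζ₂ α β) (2 * π) := by
  intro α
  simp only [cotKernelDeriv, H.half_left, Complex.cos_add_pi, Complex.sin_add_pi, H.per₁, H.per₂,
    neg_div_neg_eq, neg_sq]

theorem cotKernelDeriv_periodic_right (H : IsChordArc δ M B ζ ζ₁ ζ₂) (α : ℝ) :
    Function.Periodic (fun β => cotKernelDeriv ζ ζ₁ ζ₂ α β) (2 * π) := by
  intro β
  simp only [cotKernelDeriv, H.half_right, Complex.cos_sub_pi, Complex.sin_sub_pi, neg_div_neg_eq,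
    neg_sq]

/-- Division by `sin 0 = 0` yields zero, so the domination holds at every pair of points, the
diagonal included. -/
theorem cotKernel_self (ζ ζ₁ : ℝ → ℂ) (α : ℝ) : cotKernel ζ ζ₁ α α = 0 := by
  simp [cotKernel]

theorem cotKernelDeriv_self (ζ ζ₁ ζ₂ : ℝ → ℂ) (α : ℝ) : cotKernelDeriv ζ ζ₁ ζ₂ α α = 0 := by
  simp [cotKernelDeriv]

theorem measurable_cotKernel (H : IsChordArc δ M B ζ ζ₁ ζ₂) :
    Measurable fun p : ℝ × ℝ => (cotKernel ζ ζ₁ p.1 p.2).im := by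
  have h := H.continuous.measurable
  have h₁ := H.continuous₁.measurable
  unfold cotKernel
  fun_prop

theorem measurable_cotKernelDeriv (H : IsChordArc δ M B ζ ζ₁ ζ₂) :
    Measurable fun p : ℝ × ℝ => (cotKernelDeriv ζ ζ₁ ζ₂ p.1 p.2).im := by
  have h := H.continuous.measurable
  have h₁ := H.continuous₁.measurable
  have h₂ := H.cont₂.measurable
  unfold cotKernelDeriv
  fun_prop

/-- The chord-arc bounds cover half a period only; in the second half, compare with β + 2π, which
changes the sine only by sign. -/
theorem sin_ne_zero_of_mem_Ioo (H : IsChordArc δ M B ζ ζ₁ ζ₂) {α β : ℝ}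
    (h : α ∈ Set.Ioo β (β + 2 * π)) : Complex.sin ((ζ α - ζ β) / 2) ≠ 0 := by
  rcases le_total (α - β) π with h1 | h1
  · exact H.sin_ne_zero (abs_le.2 ⟨by linarith [h.1, Real.pi_pos], h1⟩) h.1.ne'
  · have h2 := H.sin_ne_zero (α := α) (β := β + 2 * π)
      (abs_le.2 ⟨by linarith, by linarith [h.2, Real.pi_pos]⟩) h.2.ne
    rw [H.half_right, Complex.sin_sub_pi] at h2
    exact neg_ne_zero.1 h2

theorem hasDerivAt_im_cotKernel (H : IsChordArc δ M B ζ ζ₁ ζ₂) {α β : ℝ}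
    (h : Complex.sin ((ζ α - ζ β) / 2) ≠ 0) :
    HasDerivAt (fun x => (cotKernel ζ ζ₁ x β).im) (cotKernelDeriv ζ ζ₁ ζ₂ α β).im α := by
  have hw : HasDerivAt (fun x => (ζ x - ζ β) / 2) (ζ₁ α / 2) α :=
    ((H.hasDeriv α).sub_const _).div_const 2
  have hs := (Complex.hasDerivAt_sin ((ζ α - ζ β) / 2)).comp_of_eq α hw rfl
  have hc := (Complex.hasDerivAt_cos ((ζ α - ζ β) / 2)).comp_of_eq α hw rfl
  have hk := (hc.div hs h).mul (H.hasDeriv₁ α)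
  have hi := Complex.imCLM.hasFDerivAt.comp_hasDerivAt α hk
  refine hi.congr_deriv ?_
  simp only [Complex.imCLM_apply]
  congr 1
  simp only [cotKernelDeriv, Pi.div_apply, Function.comp_apply]
  have e := Complex.sin_sq_add_cos_sq ((ζ α - ζ β) / 2)
  generalize Complex.sin ((ζ α - ζ β) / 2) = s at *
  generalize Complex.cos ((ζ α - ζ β) / 2) = c at *
  have : (-s * (ζ₁ α / 2) * s - c * (c * (ζ₁ α / 2))) = -(ζ₁ α / 2) := by
    linear_combination (-(ζ₁ α / 2)) * e
  rw [this]
  field_simp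

/-- The imaginary part of the kernel extends continuously across the diagonal. -/
theorem tendsto_im_cotKernel (H : IsChordArc δ M B ζ ζ₁ ζ₂) (β : ℝ) :
    Tendsto (fun α => (cotKernel ζ ζ₁ α β).im) (𝓝[≠] β) (𝓝 (ζ₂ β / ζ₁ β).im) := by
  have hcont : Tendsto (fun α : ℝ => |α - β|) (𝓝[≠] β) (𝓝 0) := by
    have : Continuous fun α : ℝ => |α - β| := by fun_prop
    simpa using (this.tendsto β).mono_left nhdsWithin_le_nhds
  have hnear : ∀ᶠ α in 𝓝[≠] β, M * |α - β| ≤ 1 := by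
    have : Tendsto (fun α : ℝ => M * |α - β|) (𝓝[≠] β) (𝓝 0) := by
      simpa using hcont.const_mul M
    exact (this.eventually_lt_const one_pos).mono fun _ h => h.le
  have hne : ∀ᶠ α in 𝓝[≠] β, α ≠ β := self_mem_nhdsWithin
  have l1 : Tendsto (fun α => Complex.cos ((ζ α - ζ β) / 2) / Complex.sin ((ζ α - ζ β) / 2)
      - 1 / ((ζ α - ζ β) / 2)) (𝓝[≠] β) (𝓝 0) := by
    refine squeeze_zero_norm' (a := fun α => 2 * M * |α - β|) ?_ (by simpa using hcont.const_mul _)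
    filter_upwards [hnear, hne] with α h1 h2
    refine (norm_cot_sub_inv_le_mul (H.norm_near h1)
      (div_ne_zero (H.sub_ne_zero_of_near h1 h2) two_ne_zero)).trans ?_
    rw [norm_div, Complex.norm_two]
    linarith [H.taylor_zero α β]
  have l2 : Tendsto (fun α => ((ζ α - ζ β) - ((α - β : ℝ) : ℂ) * ζ₁ α
      + ((α - β : ℝ) : ℂ) ^ 2 / 2 * ζ₂ α) / ((α - β : ℝ) : ℂ) ^ 2) (𝓝[≠] β) (𝓝 0) := by
    refine squeeze_zero_norm' (a := fun α => M * |α - β| ^ δ) ?_ ?_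
    · filter_upwards [hne] with α h2
      rw [norm_div, norm_pow, Complex.norm_real, Real.norm_eq_abs, sq_abs,
        div_le_iff₀ (by have := sub_ne_zero.2 h2; positivity)]
      exact H.taylor_two α β
    · have := (hcont.rpow_const (p := δ) (Or.inr H.delta_pos.le)).const_mul M
      simpa [Real.zero_rpow H.delta_pos.ne'] using this
  have l3 : Tendsto (fun α => ((α - β : ℝ) : ℂ) / (ζ α - ζ β)) (𝓝[≠] β) (𝓝 (ζ₁ β)⁻¹) := by
    have := (hasDerivAt_iff_tendsto_slope.1 (H.hasDeriv β)).inv₀ (H.ne_zero β)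
    refine this.congr fun α => ?_
    rw [slope_def_module, Complex.real_smul, mul_inv, Complex.ofReal_inv, inv_inv, div_eq_mul_inv]
  have c1 : Tendsto ζ₁ (𝓝[≠] β) (𝓝 (ζ₁ β)) := (H.continuous₁.tendsto β).mono_left nhdsWithin_le_nhds
  have c2 : Tendsto ζ₂ (𝓝[≠] β) (𝓝 (ζ₂ β)) := (H.cont₂.tendsto β).mono_left nhdsWithin_le_nhds
  -- With d = α - β and w the chord, cot(w/2) ζ₁ - 2/d = (cot(w/2) - 2/w) ζ₁ + (ζ₂ - 2E/d²)(d/w),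
  -- where E = w - d ζ₁ + (d²/2) ζ₂. Subtracting the real 2/d does not affect the imaginary part.
  have key := (l1.mul c1).add ((c2.sub (l2.const_mul 2)).mul l3)
  rw [zero_mul, zero_add, mul_zero, sub_zero, ← div_eq_mul_inv] at key
  have key' := (Complex.continuous_im.tendsto _).comp key
  refine key'.congr' ?_
  filter_upwards [hnear, hne] with α h1 h2
  have hw := H.sub_ne_zero_of_near h1 h2
  have hh : ((α - β : ℝ) : ℂ) ≠ 0 := by exact_mod_cast sub_ne_zero.2 h2
  have h3 : (2 / ((α - β : ℝ) : ℂ)).im = 0 := by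
    rw [show (2 / ((α - β : ℝ) : ℂ)) = ((2 / (α - β) : ℝ) : ℂ) by push_cast; rfl]
    exact Complex.ofReal_im _
  rw [Function.comp_apply, ← sub_zero (cotKernel ζ ζ₁ α β).im, ← h3, ← Complex.sub_im]
  congr 1
  unfold cotKernel
  generalize Complex.cos ((ζ α - ζ β) / 2) / Complex.sin ((ζ α - ζ β) / 2) = c
  generalize ((α - β : ℝ) : ℂ) = d at *
  generalize ζ α - ζ β = w at *
  field_simp
  ring

/-- The kernel of the operator `T`, on the circle. -/
def torusKernel (ζ ζ₁ : ℝ → ℂ) (a b : Torus) : ℝ := (cotKernel ζ ζ₁ (rep a) (rep b)).im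

/-- The kernel of the derivative of `T`, on the circle. -/
def torusKernelDeriv (ζ ζ₁ ζ₂ : ℝ → ℂ) (a b : Torus) : ℝ :=
  (cotKernelDeriv ζ ζ₁ ζ₂ (rep a) (rep b)).im

theorem torusKernel_coe (H : IsChordArc δ M B ζ ζ₁ ζ₂) (α β : ℝ) :
    torusKernel ζ ζ₁ α β = (cotKernel ζ ζ₁ α β).im := by
  unfold torusKernel
  rw [(H.cotKernel_periodic_left _).apply_rep_coe, (H.cotKernel_periodic_right _).apply_rep_coe]

theorem torusKernelDeriv_coe (H : IsChordArc δ M B ζ ζ₁ ζ₂) (α β : ℝ) :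
    torusKernelDeriv ζ ζ₁ ζ₂ α β = (cotKernelDeriv ζ ζ₁ ζ₂ α β).im := by
  unfold torusKernelDeriv
  rw [(H.cotKernelDeriv_periodic_left _).apply_rep_coe,
    (H.cotKernelDeriv_periodic_right _).apply_rep_coe]

/-- Two representatives in (-π, π] may be far apart although the points are close; here it is the
difference that is reduced. -/
theorem exists_rep_close (a b : Torus) :
    ∃ α β : ℝ, (α : Torus) = a ∧ (β : Torus) = b ∧ |α - β| ≤ π ∧ ‖a - b‖ = |α - β| := by
  refine ⟨rep a, rep a - rep (a - b), coe_rep a, ?_, ?_, ?_⟩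
  · rw [AddCircle.coe_sub, coe_rep, coe_rep, sub_sub_cancel]
  · rw [sub_sub_cancel]; exact abs_rep_le _
  · rw [sub_sub_cancel, ← norm_torus_coe (abs_rep_le _), coe_rep]

theorem measurable_torusKernel (H : IsChordArc δ M B ζ ζ₁ ζ₂) :
    Measurable (Function.uncurry (torusKernel ζ ζ₁)) := by
  have h : Measurable fun p : Torus × Torus => (rep p.1, rep p.2) :=
    (measurable_rep.comp measurable_fst).prodMk (measurable_rep.comp measurable_snd)
  have h2 := Measurable.comp (f := fun p : Torus × Torus => (rep p.1, rep p.2))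
    H.measurable_cotKernel h
  have e : Function.uncurry (torusKernel ζ ζ₁) =
      (fun p : ℝ × ℝ => (cotKernel ζ ζ₁ p.1 p.2).im) ∘
        fun p : Torus × Torus => (rep p.1, rep p.2) := by
    funext p
    simp only [Function.comp_apply, Function.uncurry, torusKernel]
  rw [e]
  exact h2

theorem isDominated_torusKernel (H : IsChordArc δ M B ζ ζ₁ ζ₂) :
    IsDominated (torusKernel ζ ζ₁) (fun a => ENNReal.ofReal (6 * B * M ^ 4) * weight δ a) := by
  refine .of_bound H.measurable_torusKernel
    H.delta_pos fun a b => ?_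
  obtain ⟨α, β, rfl, rfl, h1, h2⟩ := exists_rep_close a b
  have hB := H.B_pos
  have hM := H.M_pos
  rw [h2, H.torusKernel_coe]
  rcases eq_or_ne α β with rfl | h3
  · rw [cotKernel_self, Complex.zero_im, abs_zero]
    positivity
  · calc _ ≤ 4 * B * M ^ 2 := H.abs_im_cotKernel_le h1 h3
      _ ≤ 6 * B * M ^ 4 * 1 := by
        have : M ^ 2 ≤ M ^ 4 := pow_le_pow_right₀ H.one_le_M (by norm_num)
        have : B * M ^ 2 ≤ B * M ^ 4 := by gcongr
        have : 0 < B * M ^ 4 := by positivity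
        linarith
      _ ≤ _ := by gcongr; linarith [Real.rpow_nonneg (abs_nonneg (α - β)) (δ - 1)]

theorem measurable_torusKernelDeriv (H : IsChordArc δ M B ζ ζ₁ ζ₂) :
    Measurable (Function.uncurry (torusKernelDeriv ζ ζ₁ ζ₂)) := by
  have h : Measurable fun p : Torus × Torus => (rep p.1, rep p.2) :=
    (measurable_rep.comp measurable_fst).prodMk (measurable_rep.comp measurable_snd)
  have h2 := Measurable.comp (f := fun p : Torus × Torus => (rep p.1, rep p.2))
    H.measurable_cotKernelDeriv h
  have e : Function.uncurry (torusKernelDeriv ζ ζ₁ ζ₂) =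
      (fun p : ℝ × ℝ => (cotKernelDeriv ζ ζ₁ ζ₂ p.1 p.2).im) ∘
        fun p : Torus × Torus => (rep p.1, rep p.2) := by
    funext p
    simp only [Function.comp_apply, Function.uncurry, torusKernelDeriv]
  rw [e]
  exact h2

theorem isDominated_torusKernelDeriv (H : IsChordArc δ M B ζ ζ₁ ζ₂) :
    IsDominated (torusKernelDeriv ζ ζ₁ ζ₂)
      (fun a => ENNReal.ofReal (6 * B * M ^ 4) * weight δ a) := by
  refine .of_bound H.measurable_torusKernelDeriv
    H.delta_pos fun a b => ?_
  obtain ⟨α, β, rfl, rfl, h1, h2⟩ := exists_rep_close a b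
  have hB := H.B_pos
  have hM := H.M_pos
  rw [h2, H.torusKernelDeriv_coe]
  rcases eq_or_ne α β with rfl | h3
  · rw [cotKernelDeriv_self, Complex.zero_im, abs_zero]
    positivity
  · exact H.abs_im_cotKernelDeriv_le h1 h3

/-- Integrate over (β, β + 2π), where the only singularities are the endpoints. Im K φ has the same
limit at both ends, by periodicity and continuity across the diagonal, so the integral of its
derivative vanishes. -/
theorem integral_torusKernel_mul_deriv (H : IsChordArc δ M B ζ ζ₁ ζ₂) {φ : ℝ → ℝ}
    (hφ : ContDiff ℝ ∞ φ) (hper : Function.Periodic φ (2 * π)) (b : Torus) :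
    ∫ a, torusKernel ζ ζ₁ a b * deriv φ (rep a)
      = -∫ a, torusKernelDeriv ζ ζ₁ ζ₂ a b * φ (rep a) := by
  have hp := Real.two_pi_pos
  have hper' := hper.deriv_periodic
  have c0 : Continuous φ := hφ.continuous
  have c1 : Continuous (deriv φ) := hφ.continuous_deriv (by simp)
  obtain ⟨d0, hd0⟩ := exists_bound_comp_rep c0
  obtain ⟨d1, hd1⟩ := exists_bound_comp_rep c1
  have i1 := H.isDominated_torusKernel.integrable_left (ψ := fun a => deriv φ (rep a))
     (c1.measurable.comp measurable_rep) hd1 b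
  have i0 := H.isDominated_torusKernelDeriv.integrable_left (ψ := fun a => φ (rep a))
     (c0.measurable.comp measurable_rep)
    hd0 b
  rw [eq_neg_iff_add_eq_zero, ← integral_add i1 i0]
  set β := rep b with hβ
  rw [integral_torus_eq _ β]
  have i2 : IntervalIntegrable (fun x : ℝ => (cotKernel ζ ζ₁ x β).im * deriv φ x +
      (cotKernelDeriv ζ ζ₁ ζ₂ x β).im * φ x) volume β (β + 2 * π) := by
    rw [intervalIntegrable_iff_integrableOn_Ioc_of_le (by linarith)]
    refine ((AddCircle.measurePreserving_mk (2 * π) β).integrable_comp_of_integrable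
      (i1.add i0)).congr (Eventually.of_forall fun x => ?_)
    change torusKernel ζ ζ₁ (x : Torus) b * deriv φ (rep (x : Torus)) +
      torusKernelDeriv ζ ζ₁ ζ₂ (x : Torus) b * φ (rep (x : Torus)) = _
    rw [← coe_rep b, H.torusKernel_coe, H.torusKernelDeriv_coe, hper.apply_rep_coe,
      hper'.apply_rep_coe, ← hβ]
  have e : ∀ x : ℝ, torusKernel ζ ζ₁ (x : Torus) b * deriv φ (rep (x : Torus)) +
      torusKernelDeriv ζ ζ₁ ζ₂ (x : Torus) b * φ (rep (x : Torus))
      = (cotKernel ζ ζ₁ x β).im * deriv φ x + (cotKernelDeriv ζ ζ₁ ζ₂ x β).im * φ x := by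
    intro x
    rw [← coe_rep b, H.torusKernel_coe, H.torusKernelDeriv_coe, hper.apply_rep_coe,
      hper'.apply_rep_coe, ← hβ]
  simp_rw [e]
  have t0 := (H.tendsto_im_cotKernel β).mul ((c0.tendsto β).mono_left nhdsWithin_le_nhds)
  have tl : Tendsto (fun x => (cotKernel ζ ζ₁ x β).im * φ x) (𝓝[>] β)
      (𝓝 ((ζ₂ β / ζ₁ β).im * φ β)) :=
    t0.mono_left (nhdsWithin_mono _ fun x hx => ne_of_gt hx)
  have tr : Tendsto (fun x => (cotKernel ζ ζ₁ x β).im * φ x) (𝓝[<] (β + 2 * π))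
      (𝓝 ((ζ₂ β / ζ₁ β).im * φ β)) := by
    have h1 : Tendsto (fun x : ℝ => x - 2 * π) (𝓝[<] (β + 2 * π)) (𝓝[≠] β) := by
      refine tendsto_nhdsWithin_iff.2 ⟨?_, ?_⟩
      · have : Continuous fun x : ℝ => x - 2 * π := by fun_prop
        simpa using (this.tendsto (β + 2 * π)).mono_left nhdsWithin_le_nhds
      · filter_upwards [self_mem_nhdsWithin] with x hx
        have : x < β + 2 * π := hx
        exact ne_of_lt (by linarith)
    refine (t0.comp h1).congr fun x => ?_
    have e1 := H.cotKernel_periodic_left β (x - 2 * π)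
    have e2 := hper (x - 2 * π)
    simp only [sub_add_cancel] at e1 e2
    rw [Function.comp_apply, e1, e2]
  rw [intervalIntegral.integral_eq_sub_of_hasDerivAt_of_tendsto (by linarith) (fun x hx => ?_) i2
    tl tr, sub_self]
  have h1 := (H.hasDerivAt_im_cotKernel (H.sin_ne_zero_of_mem_Ioo hx)).mul
    ((hφ.differentiable (by simp)).differentiableAt (x := x)).hasDerivAt
  exact h1.congr_deriv (add_comm _ _)

end IsChordArc

/-! ### Bounds on the curve from the norms -/

theorem IsPeriodicCurve.deriv {z : ℝ → Plane} (h : IsPeriodicCurve z) (α : ℝ) :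
    deriv z (α + 2 * π) = deriv z α := by
  rw [← deriv_comp_add_const, show (fun x => z (x + 2 * π)) = fun x => z x + !₂[2 * π, 0] from
    funext h, deriv_add_const]

theorem IsPeriodicCurve.iteratedDeriv_two {z : ℝ → Plane} (h : IsPeriodicCurve z) (α : ℝ) :
    iteratedDeriv 2 z (α + 2 * π) = iteratedDeriv 2 z α := by
  rw [iteratedDeriv_succ, iteratedDeriv_one, ← deriv_comp_add_const, funext h.deriv]

theorem c2HolderNorm_ne_top {δ : ℝ≥0} {z : ℝ → Plane} (h : IsC2Holder δ z) :
    c2HolderNorm δ z ≠ ⊤ := by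
  refine ENNReal.add_ne_top.2 ⟨?_, h.2.eHolderNorm_lt_top.ne⟩
  refine (ENNReal.sum_lt_top.2 fun k hk => ?_).ne
  have hk' : k ≤ 2 := by have := Finset.mem_range.1 hk; omega
  have hc : Continuous (iteratedDeriv k z) := h.1.continuous_iteratedDeriv k (by exact_mod_cast hk')
  obtain ⟨c, hc⟩ := isCompact_Icc.exists_bound_of_continuousOn (s := Set.Icc (-π) π)
    hc.continuousOn
  refine lt_of_le_of_lt (iSup₂_le fun α hα => ?_) (ENNReal.ofReal_lt_top (r := c))
  rw [← ofReal_norm]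
  exact ENNReal.ofReal_le_ofReal (hc α hα)

theorem norm_iteratedDeriv_le {δ : ℝ≥0} {z : ℝ → Plane} (h : IsC2Holder δ z) {k : ℕ} (hk : k ≤ 2)
    {α : ℝ} (hα : α ∈ Set.Icc (-π) π) :
    ‖iteratedDeriv k z α‖ ≤ (c2HolderNorm δ z).toReal := by
  rw [← toReal_enorm]
  refine ENNReal.toReal_mono (c2HolderNorm_ne_top h) ?_
  calc _ ≤ ⨆ α ∈ Set.Icc (-π) π, ‖iteratedDeriv k z α‖ₑ :=
        le_iSup₂ (f := fun α (_ : α ∈ Set.Icc (-π) π) => ‖iteratedDeriv k z α‖ₑ) α hα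
    _ ≤ ∑ k ∈ Finset.range 3, ⨆ α ∈ Set.Icc (-π) π, ‖iteratedDeriv k z α‖ₑ :=
        Finset.single_le_sum (f := fun k => ⨆ α ∈ Set.Icc (-π) π, ‖iteratedDeriv k z α‖ₑ)
          (fun _ _ => zero_le) (Finset.mem_range.2 (by omega))
    _ ≤ _ := le_self_add

theorem le_of_forall_Icc_of_periodic {f : ℝ → Plane} {c : ℝ}
    (hf : Function.Periodic f (2 * π)) (h : ∀ α ∈ Set.Icc (-π) π, ‖f α‖ ≤ c) (α : ℝ) :
    ‖f α‖ ≤ c := by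
  rw [← hf.apply_rep_coe]
  exact h _ (abs_le.1 (abs_rep_le _))

theorem dist_iteratedDeriv_two_le {δ : ℝ≥0} {z : ℝ → Plane} (h : IsC2Holder δ z) (α β : ℝ) :
    ‖iteratedDeriv 2 z α - iteratedDeriv 2 z β‖
      ≤ (c2HolderNorm δ z).toReal * |α - β| ^ (δ : ℝ) := by
  have h1 := h.2.holderWith.dist_le α β
  rw [dist_eq_norm, Real.dist_eq] at h1
  refine h1.trans ?_
  gcongr
  rw [← ENNReal.coe_toReal, h.2.coe_nnHolderNorm_eq_eHolderNorm]
  exact ENNReal.toReal_mono (c2HolderNorm_ne_top h) le_add_self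

/-- The horizontal component grows by 2π over a period of length 2π, so by the mean value theorem
its derivative equals 1 somewhere. -/
theorem one_le_c2HolderNorm {δ : ℝ≥0} {z : ℝ → Plane} (hz : IsPeriodicCurve z)
    (h : IsC2Holder δ z) : 1 ≤ (c2HolderNorm δ z).toReal := by
  have hp := Real.pi_pos
  have hd : ∀ x, HasDerivAt (fun t => z t 0) (deriv z x 0) x := fun x =>
    (EuclideanSpace.proj (𝕜 := ℝ) (0 : Fin 2)).hasFDerivAt.comp_hasDerivAt x
      ((h.1.differentiable (by norm_num)) x).hasDerivAt
  obtain ⟨c, hc, he⟩ := exists_hasDerivAt_eq_slope (fun t => z t 0) (fun x => deriv z x 0)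
    (show -π < π by linarith) (fun x _ => (hd x).continuousAt.continuousWithinAt)
    (fun x _ => hd x)
  have e1 : z π 0 = z (-π) 0 + 2 * π := by
    have := hz (-π)
    rw [show -π + 2 * π = π by ring] at this
    rw [this]
    simp
  rw [e1, show (z (-π) 0 + 2 * π - z (-π) 0) / (π - -π) = 1 by field_simp; ring] at he
  have h1 := norm_iteratedDeriv_le h (k := 1) (by norm_num) ⟨hc.1.le, hc.2.le⟩
  rw [iteratedDeriv_one] at h1
  have h2 := PiLp.norm_apply_le (deriv z c) 0
  rw [he, norm_one] at h2
  exact h2.trans h1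

/-! ### The chord-arc condition -/

/-- Clearing denominators makes both sides continuous in (α, β). At β = 0 and at the poles of the
tangent the left side vanishes, so no information from the special values is needed. -/
theorem arcChord_le_imp {z : ℝ → Plane} {α β : ℝ} {F : ℝ≥0∞} (hF : F ≠ ⊤)
    (h : arcChord z α β ≤ F) :
    β ^ 2 * (cos ((z α 0 - z (α - β) 0) / 2) ^ 2 * cosh ((z α 1 - z (α - β) 1) / 2) ^ 2) ≤
      2 * F.toReal * (cosh (z α 1 - z (α - β) 1) - cos (z α 0 - z (α - β) 0)) := by
  set x := z α 0 - z (α - β) 0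
  set y := z α 1 - z (α - β) 1
  have hD : 0 ≤ cosh y - cos x := by linarith [Real.one_le_cosh y, Real.cos_le_one x]
  have hR : 0 ≤ 2 * F.toReal * (cosh y - cos x) := by positivity
  unfold arcChord at h
  split_ifs at h with h0 h1
  · simpa [h0] using hR
  · rw [h1]; simpa using hR
  · rw [tan_tanh_aux h1] at h
    have hC := Real.cosh_pos (y / 2)
    have hcc : 0 < 2 * (cos (x / 2) ^ 2 * cosh (y / 2) ^ 2) := by positivity
    have h2 : ENNReal.ofReal (β ^ 2 / 4) ≤
        F * ENNReal.ofReal ((cosh y - cos x) / (2 * (cos (x / 2) ^ 2 * cosh (y / 2) ^ 2))) := by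
      refine (ENNReal.div_le_iff_le_mul (Or.inr hF) (Or.inl ENNReal.ofReal_ne_top)).1 h
    have h3 := ENNReal.toReal_mono (ENNReal.mul_ne_top hF ENNReal.ofReal_ne_top) h2
    rw [ENNReal.toReal_mul, ENNReal.toReal_ofReal (by positivity),
      ENNReal.toReal_ofReal (by positivity), ← mul_div_assoc, le_div_iff₀ hcc] at h3
    linarith

/-- From almost everywhere to everywhere: violations of the continuous inequality form a null open
subset of the open square, hence an empty one. Closure reaches the boundary, and periodicity reaches
every α. -/
theorem arcChord_bound {z : ℝ → Plane} (hz : IsPeriodicCurve z) (hc : Continuous z)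
    (hF : arcChordNorm z ≠ ⊤) (α : ℝ) {β : ℝ} (hβ : |β| ≤ π) :
    β ^ 2 * (cos ((z α 0 - z (α - β) 0) / 2) ^ 2 * cosh ((z α 1 - z (α - β) 1) / 2) ^ 2) ≤
      2 * (arcChordNorm z).toReal *
        (cosh (z α 1 - z (α - β) 1) - cos (z α 0 - z (α - β) 0)) := by
  set F := (arcChordNorm z).toReal
  have hp := Real.pi_pos
  let f : ℝ × ℝ → ℝ := fun p => p.2 ^ 2 * (cos ((z p.1 0 - z (p.1 - p.2) 0) / 2) ^ 2 *
    cosh ((z p.1 1 - z (p.1 - p.2) 1) / 2) ^ 2)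
  let g : ℝ × ℝ → ℝ := fun p =>
    2 * F * (cosh (z p.1 1 - z (p.1 - p.2) 1) - cos (z p.1 0 - z (p.1 - p.2) 0))
  have hf : Continuous f := by fun_prop
  have hg : Continuous g := by fun_prop
  have hsq : IsOpen (Set.Ioo (-π) π ×ˢ Set.Ioo (-π) π) := isOpen_Ioo.prod isOpen_Ioo
  have hae : ∀ᵐ p : ℝ × ℝ, p ∈ Set.Ioo (-π) π ×ˢ Set.Ioo (-π) π → f p ≤ g p := by
    rw [← ae_restrict_iff' hsq.measurableSet]
    filter_upwards [ENNReal.ae_le_essSup (μ := volume.restrict (Set.Ioo (-π) π ×ˢ Set.Ioo (-π) π))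
      fun p : ℝ × ℝ => arcChord z p.1 p.2] with p hp
    exact arcChord_le_imp hF hp
  have hopen : IsOpen ((Set.Ioo (-π) π ×ˢ Set.Ioo (-π) π) ∩ {p | g p < f p}) :=
    hsq.inter (isOpen_lt hg hf)
  have hempty := hopen.eq_empty_of_measure_zero (μ := volume) (by
    refine measure_mono_null ?_ (ae_iff.1 hae)
    rintro p ⟨h1, h2⟩
    simp only [Set.mem_ofPred_eq, Classical.not_imp, not_le]
    exact ⟨h1, h2⟩)
  have hin : Set.Ioo (-π) π ×ˢ Set.Ioo (-π) π ⊆ {p | f p ≤ g p} := by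
    intro p h1
    by_contra h2
    simp only [Set.mem_ofPred_eq, not_le] at h2
    exact Set.notMem_empty p (hempty ▸ ⟨h1, h2⟩)
  have hcl := closure_minimal hin (isClosed_le hf hg)
  rw [closure_prod_eq, closure_Ioo (by linarith)] at hcl
  have hper : Function.Periodic (fun α => z α - z (α - β)) (2 * π) := by
    intro x
    simp only
    rw [hz, show x + 2 * π - β = (x - β) + 2 * π by ring, hz]
    abel
  have e := hper.apply_rep_coe α
  have e0 := congrArg (fun v : Plane => v 0) e
  have e1 := congrArg (fun v : Plane => v 1) e
  simp only [PiLp.sub_apply] at e0 e1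
  have key : f (rep (α : Torus), β) ≤ g (rep (α : Torus), β) :=
    hcl ⟨abs_le.1 (abs_rep_le _), abs_le.1 hβ⟩
  simp only [f, g, e0, e1] at key
  exact key

theorem normSq_sin_add_mul_I (x y : ℝ) :
    ‖Complex.sin (x + y * Complex.I)‖ ^ 2 = cosh y ^ 2 - cos x ^ 2 := by
  rw [Complex.sin_add_mul_I, Complex.sq_norm, Complex.normSq_apply]
  simp only [← Complex.ofReal_sin, ← Complex.ofReal_cos, ← Complex.ofReal_cosh,
    ← Complex.ofReal_sinh, ← Complex.ofReal_mul, Complex.add_re, Complex.add_im,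
    Complex.re_ofReal_mul, Complex.im_ofReal_mul, Complex.ofReal_re, Complex.ofReal_im,
    Complex.I_re, Complex.I_im]
  have h1 := Real.sin_sq_add_cos_sq x
  have h2 := Real.cosh_sq y
  have h3 : sin x ^ 2 = 1 - cos x ^ 2 := by linarith
  ring_nf
  rw [h3, h2]
  ring

theorem normSq_cos_add_mul_I (x y : ℝ) :
    ‖Complex.cos (x + y * Complex.I)‖ ^ 2 = cosh y ^ 2 + cos x ^ 2 - 1 := by
  rw [Complex.cos_add_mul_I, Complex.sq_norm, Complex.normSq_apply]
  simp only [← Complex.ofReal_sin, ← Complex.ofReal_cos, ← Complex.ofReal_cosh,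
    ← Complex.ofReal_sinh, ← Complex.ofReal_mul, Complex.sub_re, Complex.sub_im,
    Complex.re_ofReal_mul, Complex.im_ofReal_mul, Complex.ofReal_re, Complex.ofReal_im,
    Complex.I_re, Complex.I_im]
  have h1 := Real.sin_sq_add_cos_sq x
  have h2 := Real.cosh_sq y
  have h3 : sin x ^ 2 = 1 - cos x ^ 2 := by linarith
  ring_nf
  rw [h3, h2]
  ring

theorem cosh_sub_cos_eq (x y : ℝ) :
    cosh y - cos x = 2 * (cosh (y / 2) ^ 2 - cos (x / 2) ^ 2) := by
  have e1 : cos x = 2 * cos (x / 2) ^ 2 - 1 := by rw [← Real.cos_two_mul]; ring_nf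
  have e2 : cosh y = cosh (y / 2) ^ 2 + sinh (y / 2) ^ 2 := by rw [← Real.cosh_two_mul]; ring_nf
  rw [e1, e2, Real.sinh_sq]
  ring

/-- The arc-chord norm is bounded below by an absolute constant. -/
theorem le_arcChordNorm {z : ℝ → Plane} (hz : IsPeriodicCurve z) (hc : Continuous z)
    (hF : arcChordNorm z ≠ ⊤) : 1 / 32 ≤ (arcChordNorm z).toReal := by
  set F := (arcChordNorm z).toReal with hFdef
  have hF0 : 0 ≤ F := ENNReal.toReal_nonneg
  have h3 := Real.pi_gt_three
  have key : ∀ α β : ℝ, |β| ≤ π → β ^ 2 * cos ((z α 0 - z (α - β) 0) / 2) ^ 2 ≤ 4 * F := by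
    intro α β hβ
    have h := arcChord_bound hz hc hF α hβ
    rw [cosh_sub_cos_eq, ← hFdef] at h
    have hC := Real.cosh_pos ((z α 1 - z (α - β) 1) / 2)
    refine le_of_mul_le_mul_right ?_ (pow_pos hC 2)
    nlinarith [sq_nonneg (cos ((z α 0 - z (α - β) 0) / 2))]
  -- Three points of the curve suffice. If F < 1/32, the half-differences a, b over consecutive unit
  -- steps have cos² ≤ 1/8, so |sin a sin b| ≥ 7/8 and |cos a cos b| ≤ 1/8. Then |cos(a + b)| ≥ 3/4,
  -- against the bound for the step of length 2.
  have k1 := key 0 1 (by rw [abs_one]; linarith)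
  have k2 := key (-1) 1 (by rw [abs_one]; linarith)
  have k3 := key 0 2 (by rw [abs_two]; linarith)
  rw [show (-1 : ℝ) - 1 = 0 - 2 by norm_num, show (-1 : ℝ) = 0 - 1 by norm_num] at k2
  set a := (z 0 0 - z (0 - 1) 0) / 2
  set b := (z (0 - 1) 0 - z (0 - 2) 0) / 2
  rw [show (z 0 0 - z (0 - 2) 0) / 2 = a + b by simp only [a, b]; ring, Real.cos_add] at k3
  have s1 := Real.sin_sq_add_cos_sq a
  have s2 := Real.sin_sq_add_cos_sq b
  by_contra! hlt
  have p1 : cos a ^ 2 ≤ 1 / 8 := by linarith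
  have p2 : cos b ^ 2 ≤ 1 / 8 := by linarith
  have p3 : (cos a * cos b - sin a * sin b) ^ 2 ≤ 1 / 32 := by linarith
  have p4 : 49 / 64 ≤ (sin a * sin b) ^ 2 := by
    rw [mul_pow]
    nlinarith
  have p5 : (cos a * cos b) ^ 2 ≤ 1 / 64 := by
    rw [mul_pow]
    nlinarith [sq_nonneg (cos a), sq_nonneg (cos b)]
  nlinarith [sq_nonneg (2 * (cos a * cos b) - sin a * sin b),
    sq_nonneg ((cos a * cos b - sin a * sin b) + cos a * cos b)]

/-- The identification of the plane with `ℂ`. -/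
def toComplex : Plane ≃ₗᵢ[ℝ] ℂ := Complex.orthonormalBasisOneI.repr.symm

theorem toComplex_apply (v : Plane) : toComplex v = v 0 + v 1 * Complex.I :=
  Complex.orthonormalBasisOneI_repr_symm_apply v

/-- Here |sin|² = C² - c², with C and c the cosh and cos of the half-differences. If c² ≥ 1/2, the
factor c² in `arcChord_bound` can be dropped. If c² ≤ 1/2, then C² ≤ 2(C² - c²) and (α - β)² ≤ 10;
the constant is 640 = 20 · 32 because F ≥ 1/32. -/
theorem arcChord_bound_complex {z : ℝ → Plane} (hz : IsPeriodicCurve z) (hc : Continuous z)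
    (hF : arcChordNorm z ≠ ⊤) {α β : ℝ} (h : |α - β| ≤ π) :
    (α - β) ^ 2 * cosh ((z α 1 - z β 1) / 2) ^ 2 ≤ 640 * (arcChordNorm z).toReal *
      ‖Complex.sin ((toComplex (z α) - toComplex (z β)) / 2)‖ ^ 2 := by
  have hb := arcChord_bound hz hc hF α h
  have hl := le_arcChordNorm hz hc hF
  set F := (arcChordNorm z).toReal with hFdef
  rw [sub_sub_cancel, cosh_sub_cos_eq] at hb
  have e : (toComplex (z α) - toComplex (z β)) / 2
      = (((z α 0 - z β 0) / 2 : ℝ) : ℂ) + (((z α 1 - z β 1) / 2 : ℝ) : ℂ) * Complex.I := by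
    rw [toComplex_apply, toComplex_apply]
    push_cast
    ring
  rw [e, normSq_sin_add_mul_I]
  have hC := Real.one_le_cosh ((z α 1 - z β 1) / 2)
  set C := cosh ((z α 1 - z β 1) / 2)
  set c := cos ((z α 0 - z β 0) / 2)
  have hC2 : 1 ≤ C ^ 2 := one_le_pow₀ hC
  have hs : (α - β) ^ 2 ≤ 10 := by
    rw [← sq_abs]
    have := Real.pi_lt_d2
    have := abs_nonneg (α - β)
    nlinarith
  have hs0 := sq_nonneg (α - β)
  rcases le_total (c ^ 2) (1 / 2) with h1 | h1
  · have h2 : C ^ 2 / 2 ≤ C ^ 2 - c ^ 2 := by linarith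
    calc (α - β) ^ 2 * C ^ 2 ≤ 10 * C ^ 2 := by gcongr
      _ = 20 * (C ^ 2 / 2) := by ring
      _ ≤ 640 * F * (C ^ 2 - c ^ 2) := by
        gcongr
        linarith
  · have h2 : 0 ≤ (α - β) ^ 2 * C ^ 2 := by positivity
    have h3 : (α - β) ^ 2 * C ^ 2 * (1 / 2) ≤ (α - β) ^ 2 * C ^ 2 * c ^ 2 := by gcongr
    nlinarith

theorem isChordArc {δ : ℝ≥0} (hδ : 0 < δ) {z : ℝ → Plane} (hz : IsPeriodicCurve z)
    (h : IsC2Holder δ z) (hF : arcChordNorm z ≠ ⊤) :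
    IsChordArc δ (c2HolderNorm δ z).toReal (640 * (arcChordNorm z).toReal)
      (fun α => toComplex (z α)) (fun α => toComplex (deriv z α))
      (fun α => toComplex (iteratedDeriv 2 z α)) := by
  have hc := h.1.continuous
  have hl := le_arcChordNorm hz hc hF
  have d0 : ∀ α, HasDerivAt (fun α => toComplex (z α)) (toComplex (deriv z α)) α := fun α =>
    toComplex.toContinuousLinearEquiv.hasFDerivAt.comp_hasDerivAt α
      ((h.1.differentiable (by norm_num)) α).hasDerivAt
  have d1 : ∀ α, HasDerivAt (fun α => toComplex (deriv z α)) (toComplex (iteratedDeriv 2 z α)) α := by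
    intro α
    have h1 : ContDiff ℝ 1 (deriv z) := by
      have := h.1
      rw [show (2 : ℕ∞ω) = 1 + 1 by norm_num, contDiff_succ_iff_deriv] at this
      exact this.2.2
    refine toComplex.toContinuousLinearEquiv.hasFDerivAt.comp_hasDerivAt α ?_
    rw [iteratedDeriv_succ, iteratedDeriv_one]
    exact ((h1.differentiable (by norm_num)) α).hasDerivAt
  have sin_bound : ∀ α β, |α - β| ≤ π → (α - β) ^ 2 ≤ 640 * (arcChordNorm z).toReal *
      ‖Complex.sin ((toComplex (z α) - toComplex (z β)) / 2)‖ ^ 2 := by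
    intro α β hab
    refine le_trans ?_ (arcChord_bound_complex hz hc hF hab)
    exact le_mul_of_one_le_right (sq_nonneg _) (one_le_pow₀ (Real.one_le_cosh _))
  refine
    { one_le_M := one_le_c2HolderNorm hz h
      one_le_B := by linarith
      delta_pos := by exact_mod_cast hδ
      hasDeriv := d0
      hasDeriv₁ := d1
      cont₂ := toComplex.continuous.comp (h.1.continuous_iteratedDeriv 2 le_rfl)
      norm₁ := fun α => ?_
      norm₂ := fun α => ?_
      holder := fun α β => ?_
      ne_zero := fun β h0 => ?_
      per := fun α => ?_
      per₁ := fun α => by rw [hz.deriv]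
      per₂ := fun α => by rw [hz.iteratedDeriv_two]
      arc_sin := sin_bound
      arc_cos := fun α β hab => ?_ }
  · rw [LinearIsometryEquiv.norm_map]
    refine le_of_forall_Icc_of_periodic hz.deriv (fun x hx => ?_) α
    rw [← iteratedDeriv_one]
    exact norm_iteratedDeriv_le h (by norm_num) hx
  · rw [LinearIsometryEquiv.norm_map]
    exact le_of_forall_Icc_of_periodic hz.iteratedDeriv_two
      (fun x hx => norm_iteratedDeriv_le h le_rfl hx) α
  · rw [← map_sub, LinearIsometryEquiv.norm_map]
    exact dist_iteratedDeriv_two_le h α β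
  -- A vanishing tangent would make the sine o(x - β); dividing the chord-arc inequality by (x - β)²
  -- and letting x → β would give 1 ≤ 0.
  · have hd : HasDerivAt (fun x => Complex.sin ((toComplex (z x) - toComplex (z β)) / 2)) 0 β := by
      have hw := ((d0 β).sub_const (toComplex (z β))).div_const 2
      have := (Complex.hasDerivAt_sin ((toComplex (z β) - toComplex (z β)) / 2)).comp_of_eq β hw rfl
      refine this.congr_deriv ?_
      rw [h0]; simp
    have ht := (((hasDerivAt_iff_tendsto_slope.1 hd).norm.pow 2).const_mul
      (640 * (arcChordNorm z).toReal))
    have hnear : ∀ᶠ x in 𝓝[≠] β, |x - β| ≤ π := by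
      have : Continuous fun x : ℝ => |x - β| := by fun_prop
      have := (this.tendsto β).mono_left (nhdsWithin_le_nhds (s := {β}ᶜ))
      exact (this.eventually_lt_const (by simpa using Real.pi_pos)).mono fun _ h => h.le
    have h1 : (1 : ℝ) ≤ 640 * (arcChordNorm z).toReal * ‖(0 : ℂ)‖ ^ 2 := by
      refine ge_of_tendsto ht ?_
      filter_upwards [hnear, self_mem_nhdsWithin] with x hx hne
      have hne' : x - β ≠ 0 := sub_ne_zero.2 hne
      have hb := sin_bound x β hx
      rw [slope_def_module, sub_self, zero_div, Complex.sin_zero, sub_zero, norm_smul, mul_pow,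
        norm_inv, Real.norm_eq_abs, inv_pow, sq_abs, mul_left_comm, ← div_eq_inv_mul,
        le_div_iff₀ (by positivity), one_mul]
      exact hb
    simp at h1
    linarith
  · rw [hz, map_add, toComplex_apply !₂[2 * π, 0]]
    simp
  · refine le_trans ?_ (arcChord_bound_complex hz hc hF hab)
    refine mul_le_mul_of_nonneg_left ?_ (sq_nonneg _)
    have e : (toComplex (z α) - toComplex (z β)) / 2
        = (((z α 0 - z β 0) / 2 : ℝ) : ℂ) + (((z α 1 - z β 1) / 2 : ℝ) : ℂ) * Complex.I := by
      rw [toComplex_apply, toComplex_apply]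
      push_cast
      ring
    rw [e, normSq_cos_add_mul_I]
    linarith [Real.cos_sq_le_one ((z α 0 - z β 0) / 2)]

/-! ### Approximate identities at Lebesgue points -/

/-- The profile `ε / (ε² + x²)`. -/
def profile (ε x : ℝ) : ℝ := ε / (ε ^ 2 + x ^ 2)

theorem profile_nonneg {ε : ℝ} (hε : 0 ≤ ε) (x : ℝ) : 0 ≤ profile ε x := by
  unfold profile; positivity

/-- Take the least j with |x| ≤ 2^j ε: minimality gives |x| > 2^(j-1) ε when j > 0, whence the
factor 4. -/
theorem exists_profile_le {ε : ℝ} (hε : 0 < ε) (x : ℝ) :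
    ∃ j : ℕ, |x| ≤ 2 ^ j * ε ∧ profile ε x ≤ 4 / (4 ^ j * ε) := by
  have hex : ∃ j : ℕ, |x| ≤ 2 ^ j * ε := by
    obtain ⟨j, hj⟩ := pow_unbounded_of_one_lt (|x| / ε) (one_lt_two (α := ℝ))
    exact ⟨j, by rw [div_lt_iff₀ hε] at hj; exact hj.le⟩
  classical
  refine ⟨Nat.find hex, Nat.find_spec hex, ?_⟩
  unfold profile
  rcases hj : Nat.find hex with _ | j
  · rw [div_le_div_iff₀ (by positivity) (by positivity)]
    simp only [pow_zero, one_mul]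
    nlinarith [sq_nonneg x, mul_pos hε hε]
  · have h1 : ¬ |x| ≤ 2 ^ j * ε := Nat.find_min hex (by omega)
    push Not at h1
    have h2 : (2 ^ j * ε) ^ 2 ≤ x ^ 2 := by
      rw [← sq_abs x]; gcongr
    rw [mul_pow, ← pow_mul, mul_comm j 2, pow_mul] at h2
    norm_num at h2
    rw [div_le_div_iff₀ (by positivity) (by positivity), pow_succ]
    nlinarith [mul_pos hε hε]

/-- Dyadic majorization by balls bounds the integral by ∑ 4 · 2^(-j) m(2^j ε), where m(s) is the
mass of the ball divided by s. Each term tends to 0 and m is bounded, so dominated convergence for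
series applies. -/
theorem tendsto_lintegral_profile {μ : Measure ℝ} {f : ℝ → ℝ≥0∞} (hf : Measurable f)
    (hfin : ∫⁻ x, f x ∂μ ≠ ⊤) (α : ℝ)
    (hL : Tendsto (fun s => (∫⁻ x in Metric.closedBall α s, f x ∂μ).toReal / s)
      (𝓝[>] 0) (𝓝 0)) :
    Tendsto (fun ε => ∫⁻ x, ENNReal.ofReal (profile ε (α - x)) * f x ∂μ) (𝓝[>] 0) (𝓝 0) := by
  set m : ℝ → ℝ := fun s => (∫⁻ x in Metric.closedBall α s, f x ∂μ).toReal / s with hm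
  have hfin' : ∀ s, ∫⁻ x in Metric.closedBall α s, f x ∂μ ≠ ⊤ := fun s =>
    ne_top_of_le_ne_top hfin (setLIntegral_le_lintegral _ _)
  have hm0 : ∀ s, 0 < s → 0 ≤ m s := fun s hs => by simp only [hm]; positivity
  -- Small radii are controlled by the limit, large ones by the total mass.
  obtain ⟨K, hK0, hK⟩ : ∃ K, 0 ≤ K ∧ ∀ s, 0 < s → m s ≤ K := by
    obtain ⟨s0, hs0, h1⟩ := mem_nhdsGT_iff_exists_Ioo_subset.1 (hL.eventually_lt_const one_pos)
    have hs0' : 0 < s0 := hs0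
    refine ⟨1 + (∫⁻ x, f x ∂μ).toReal / s0, by positivity, fun s hs => ?_⟩
    have h2 : 0 ≤ (∫⁻ x, f x ∂μ).toReal / s0 := by positivity
    rcases lt_or_ge s s0 with h | h
    · have h3 : m s < 1 := h1 ⟨hs, h⟩
      linarith
    · have h4 : m s ≤ (∫⁻ x, f x ∂μ).toReal / s0 := by
        simp only [hm]
        gcongr
        exact Measure.restrict_le_self
      linarith
  have hgeo : Summable fun j : ℕ => 4 * K * (1 / 2 : ℝ) ^ j :=
    summable_geometric_two.mul_left _
  have hser : Tendsto (fun ε => ∑' j : ℕ, 4 * (1 / 2 : ℝ) ^ j * m (2 ^ j * ε))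
      (𝓝[>] 0) (𝓝 (∑' _ : ℕ, (0 : ℝ))) := by
    refine tendsto_tsum_of_dominated_convergence hgeo (fun j => ?_) ?_
    · have h1 : Tendsto (fun ε : ℝ => 2 ^ j * ε) (𝓝[>] 0) (𝓝[>] 0) := by
        refine tendsto_nhdsWithin_iff.2 ⟨?_, ?_⟩
        · have : Continuous fun ε : ℝ => 2 ^ j * ε := by fun_prop
          simpa using (this.tendsto 0).mono_left nhdsWithin_le_nhds
        · filter_upwards [self_mem_nhdsWithin] with ε hε
          have : 0 < ε := hε
          exact Set.mem_Ioi.2 (by positivity)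
      simpa using (hL.comp h1).const_mul (4 * (1 / 2 : ℝ) ^ j)
    · filter_upwards [self_mem_nhdsWithin] with ε hε j
      have hε' : 0 < ε := hε
      have h2 := hm0 (2 ^ j * ε) (by positivity)
      rw [Real.norm_of_nonneg (by positivity)]
      have := hK (2 ^ j * ε) (by positivity)
      calc _ ≤ 4 * (1 / 2 : ℝ) ^ j * K := by gcongr
        _ = _ := by ring
  rw [tsum_zero] at hser
  have hser' := ENNReal.tendsto_ofReal hser
  rw [ENNReal.ofReal_zero] at hser'
  refine tendsto_of_tendsto_of_tendsto_of_le_of_le' tendsto_const_nhds hser'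
    (Eventually.of_forall fun _ => zero_le) ?_
  filter_upwards [self_mem_nhdsWithin] with ε hε
  have hε' : 0 < ε := hε
  have hsum : Summable fun j : ℕ => 4 * (1 / 2 : ℝ) ^ j * m (2 ^ j * ε) := by
    refine Summable.of_nonneg_of_le (fun j => ?_) (fun j => ?_) hgeo
    · have h2 := hm0 (2 ^ j * ε) (by positivity)
      positivity
    · have := hK (2 ^ j * ε) (by positivity)
      calc _ ≤ 4 * (1 / 2 : ℝ) ^ j * K := by gcongr
        _ = _ := by ring
  rw [ENNReal.ofReal_tsum_of_nonneg (fun j => by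
    have h2 := hm0 (2 ^ j * ε) (by positivity)
    positivity) hsum]
  calc ∫⁻ x, ENNReal.ofReal (profile ε (α - x)) * f x ∂μ
      ≤ ∫⁻ x, ∑' j : ℕ, ENNReal.ofReal (4 / (4 ^ j * ε)) *
          (Metric.closedBall α (2 ^ j * ε)).indicator f x ∂μ := by
        refine lintegral_mono fun x => ?_
        obtain ⟨j, h1, h2⟩ := exists_profile_le hε' (α - x)
        refine le_trans ?_ (ENNReal.le_tsum j)
        rw [Set.indicator_of_mem (by rwa [Metric.mem_closedBall', Real.dist_eq])]
        gcongr
    _ = ∑' j : ℕ, ENNReal.ofReal (4 / (4 ^ j * ε)) *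
          ∫⁻ x in Metric.closedBall α (2 ^ j * ε), f x ∂μ := by
        rw [lintegral_tsum fun j =>
          ((hf.indicator Metric.isClosed_closedBall.measurableSet).const_mul _).aemeasurable]
        refine tsum_congr fun j => ?_
        rw [lintegral_const_mul _ (hf.indicator Metric.isClosed_closedBall.measurableSet),
          lintegral_indicator Metric.isClosed_closedBall.measurableSet]
    _ = _ := by
        refine tsum_congr fun j => ?_
        rw [← ENNReal.ofReal_toReal (hfin' (2 ^ j * ε)), ← ENNReal.ofReal_mul (by positivity)]
        congr 1
        simp only [hm]
        have e : (4 : ℝ) ^ j = 2 ^ j * 2 ^ j := by rw [← mul_pow]; norm_num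
        rw [e, one_div, inv_pow]
        field_simp

/-- `α` is a Lebesgue point of `f`. -/
def IsLebesguePoint (f : ℝ → ℂ) (α : ℝ) : Prop :=
  Tendsto (fun s => ⨍ y in Metric.closedBall α s, ‖f y - f α‖) (𝓝[>] 0) (𝓝 0)

theorem ae_isLebesguePoint {f : ℝ → ℂ} (hf : LocallyIntegrable f) :
    ∀ᵐ α : ℝ, IsLebesguePoint f α := by
  filter_upwards [IsUnifLocDoublingMeasure.ae_tendsto_average_norm_sub volume hf 1] with α hα
  refine hα (fun _ => α) id tendsto_id ?_
  filter_upwards [self_mem_nhdsWithin] with s hs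
  have : (0 : ℝ) < s := hs
  simpa using this.le

/-- The interval of length `2π` centred at `α`. -/
def period (α : ℝ) : Set ℝ := {β | |α - β| < π}

theorem period_eq (α : ℝ) : period α = Set.Ioo (α - π) (α + π) := by
  ext β
  rw [period, Set.mem_ofPred_eq, abs_lt, Set.mem_Ioo]
  constructor <;> rintro ⟨h1, h2⟩ <;> constructor <;> linarith

theorem measurableSet_period (α : ℝ) : MeasurableSet (period α) := by
  rw [period_eq]; exact measurableSet_Ioo

theorem volume_period_ne_top (α : ℝ) : volume (period α) ≠ ⊤ := by
  rw [period_eq]; simp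

theorem tendsto_integral_kernel_sub {f : ℝ → ℂ} (hm : Measurable f) (hf : LocallyIntegrable f)
    {α : ℝ} (hα : IsLebesguePoint f α) {k : ℝ → ℝ → ℝ} {A : ℝ}
    (hk : ∀ᶠ ε in 𝓝[>] (0 : ℝ), ∀ x, |x| < π → |k ε x| ≤ A * profile ε x) :
    Tendsto (fun ε => ∫ β in period α, (k ε (α - β) : ℂ) * (f β - f α)) (𝓝[>] 0) (𝓝 0) := by
  have hlf : LocallyIntegrable fun y => f y - f α := hf.sub (locallyIntegrable_const _)
  have hint : IntegrableOn (fun y => f y - f α) (period α) := by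
    rw [period_eq]
    exact (hlf.integrableOn_isCompact isCompact_Icc).mono_set Set.Ioo_subset_Icc_self
  have hfm : Measurable fun y => ‖f y - f α‖ₑ := by fun_prop
  have hL : Tendsto (fun s => (∫⁻ y in Metric.closedBall α s, ‖f y - f α‖ₑ
      ∂(volume.restrict (period α))).toReal / s) (𝓝[>] 0) (𝓝 0) := by
    refine squeeze_zero' (g := fun s => 2 * ⨍ y in Metric.closedBall α s, ‖f y - f α‖) ?_ ?_
      (by simpa using hα.const_mul 2)
    · filter_upwards [self_mem_nhdsWithin] with s hs
      have : (0 : ℝ) < s := hs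
      positivity
    · filter_upwards [self_mem_nhdsWithin] with s hs
      have hs' : (0 : ℝ) < s := hs
      have hi : IntegrableOn (fun y => f y - f α) (Metric.closedBall α s) :=
        hlf.integrableOn_isCompact (isCompact_closedBall α s)
      rw [setAverage_eq, measureReal_def, Real.volume_closedBall,
        ENNReal.toReal_ofReal (by positivity), smul_eq_mul,
        integral_norm_eq_lintegral_enorm hi.aestronglyMeasurable]
      have : (∫⁻ y in Metric.closedBall α s, ‖f y - f α‖ₑ ∂(volume.restrict (period α))).toReal ≤
          (∫⁻ y in Metric.closedBall α s, ‖f y - f α‖ₑ).toReal :=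
        ENNReal.toReal_mono hi.2.ne (lintegral_mono' (Measure.restrict_mono le_rfl
          Measure.restrict_le_self) le_rfl)
      rw [div_le_iff₀ hs']
      refine this.trans (le_of_eq ?_)
      field_simp
  have key := tendsto_lintegral_profile hfm hint.2.ne α hL
  have key2 : Tendsto (fun ε => ENNReal.ofReal A * ∫⁻ β in period α,
      ENNReal.ofReal (profile ε (α - β)) * ‖f β - f α‖ₑ) (𝓝[>] 0) (𝓝 0) := by
    simpa using ENNReal.Tendsto.const_mul key (Or.inr ENNReal.ofReal_ne_top)
  have key3 := (ENNReal.tendsto_toReal ENNReal.zero_ne_top).comp key2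
  rw [ENNReal.toReal_zero] at key3
  refine squeeze_zero_norm' ?_ key3
  have hfin : ∀ᶠ ε in 𝓝[>] (0 : ℝ), ENNReal.ofReal A * ∫⁻ β in period α,
      ENNReal.ofReal (profile ε (α - β)) * ‖f β - f α‖ₑ < ⊤ :=
    key2.eventually_lt_const ENNReal.zero_lt_top
  filter_upwards [hk, self_mem_nhdsWithin, hfin] with ε h1 h2 h3
  refine (norm_integral_le_lintegral_norm _).trans (ENNReal.toReal_mono h3.ne ?_)
  simp only
  rw [← lintegral_const_mul' _ _ ENNReal.ofReal_ne_top]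
  refine setLIntegral_mono' (measurableSet_period α) fun β hβ => ?_
  have h4 := h1 (α - β) hβ
  have hp := profile_nonneg (le_of_lt h2) (α - β)
  rw [norm_mul, Complex.norm_real, Real.norm_eq_abs, ENNReal.ofReal_mul (abs_nonneg _),
    ofReal_norm, ← mul_assoc, ← ENNReal.ofReal_mul' hp]
  gcongr

/-! ### The Poisson kernel and its conjugate -/

/-- The Poisson kernel `(1 - r²) / (1 - 2 r cos x + r²)`. -/
def poisson (r x : ℝ) : ℝ := (1 - r ^ 2) / (1 - 2 * r * cos x + r ^ 2)

/-- The conjugate Poisson kernel `2 r sin x / (1 - 2 r cos x + r²)`. -/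
def conjPoisson (r x : ℝ) : ℝ := 2 * r * sin x / (1 - 2 * r * cos x + r ^ 2)

theorem sq_one_sub_le {r : ℝ} (hr : 0 ≤ r) (x : ℝ) :
    (1 - r) ^ 2 ≤ 1 - 2 * r * cos x + r ^ 2 := by
  nlinarith [Real.cos_le_one x]

theorem fourier_coe_torus (n : ℤ) (x : ℝ) :
    fourier n (x : Torus) = Complex.exp (x * Complex.I) ^ n := by
  rw [fourier_coe_apply, ← Complex.exp_int_mul]
  congr 1
  have : (π : ℂ) ≠ 0 := by exact_mod_cast Real.pi_ne_zero
  push_cast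
  field_simp

theorem norm_ofReal_mul_exp {r : ℝ} (hr : 0 ≤ r) (x : ℝ) :
    ‖(r : ℂ) * Complex.exp (x * Complex.I)‖ = r := by
  rw [norm_mul, Complex.norm_exp_ofReal_mul_I, Complex.norm_real, Real.norm_of_nonneg hr, mul_one]

theorem one_sub_mul_exp_mul (r x : ℝ) :
    (1 - (r : ℂ) * Complex.exp (x * Complex.I)) * (1 - (r : ℂ) * Complex.exp ((-x : ℝ) * Complex.I))
      = ((1 - 2 * r * cos x + r ^ 2 : ℝ) : ℂ) := by
  have h : Complex.exp (x * Complex.I) * Complex.exp ((-x : ℝ) * Complex.I) = 1 := by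
    rw [← Complex.exp_add]; simp
  have h2 : Complex.exp (x * Complex.I) + Complex.exp ((-x : ℝ) * Complex.I) = 2 * Complex.cos x := by
    rw [Complex.cos]; push_cast; ring_nf
  push_cast at h h2 ⊢
  linear_combination (r : ℂ) ^ 2 * h - (r : ℂ) * h2

theorem hasSum_geometric_pair {r : ℝ} (hr : 0 ≤ r) (hr1 : r < 1) (x : ℝ) :
    HasSum (fun n : ℕ => (r : ℂ) ^ n * fourier (n : ℤ) (x : Torus))
      (1 - (r : ℂ) * Complex.exp (x * Complex.I))⁻¹ ∧
    HasSum (fun n : ℕ => (r : ℂ) ^ (n + 1) * fourier (-((n : ℤ) + 1)) (x : Torus))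
      ((r : ℂ) * Complex.exp ((-x : ℝ) * Complex.I) *
        (1 - (r : ℂ) * Complex.exp ((-x : ℝ) * Complex.I))⁻¹) := by
  constructor
  · refine (hasSum_geometric_of_norm_lt_one (ξ := (r : ℂ) * Complex.exp (x * Complex.I))
      (by rwa [norm_ofReal_mul_exp hr])).congr_fun fun n => ?_
    rw [fourier_coe_torus, mul_pow, zpow_natCast]
  · refine ((hasSum_geometric_of_norm_lt_one (ξ := (r : ℂ) * Complex.exp ((-x : ℝ) * Complex.I))
      (by rwa [norm_ofReal_mul_exp hr])).mul_left _).congr_fun fun n => ?_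
    have e : fourier (-((n : ℤ) + 1)) (x : Torus) = Complex.exp ((-x : ℝ) * Complex.I) ^ (n + 1) := by
      rw [fourier_coe_torus, zpow_neg, ← inv_zpow, ← Complex.exp_neg]
      push_cast
      rw [neg_mul]
      exact zpow_natCast _ (n + 1)
    rw [e, pow_succ, pow_succ, mul_pow]
    ring

theorem hasSum_poisson {r : ℝ} (hr : 0 ≤ r) (hr1 : r < 1) (x : ℝ) :
    HasSum (fun n : ℤ => (r : ℂ) ^ n.natAbs * fourier n (x : Torus)) (poisson r x : ℂ) := by
  obtain ⟨h1, h2⟩ := hasSum_geometric_pair hr hr1 x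
  have key := HasSum.of_nat_of_neg_add_one
    (f := fun n : ℤ => (r : ℂ) ^ n.natAbs * fourier n (x : Torus)) h1 h2
  convert key using 1
  have hD := one_sub_mul_exp_mul r x
  have hpos : 0 < 1 - 2 * r * cos x + r ^ 2 :=
    lt_of_lt_of_le (by have := sub_pos.2 hr1; positivity) (sq_one_sub_le hr x)
  have hne : ((1 - 2 * r * cos x + r ^ 2 : ℝ) : ℂ) ≠ 0 := by exact_mod_cast hpos.ne'
  have h : Complex.exp (x * Complex.I) * Complex.exp ((-x : ℝ) * Complex.I) = 1 := by
    rw [← Complex.exp_add]; simp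
  rw [← hD] at hne
  have ha := left_ne_zero_of_mul hne
  have hb := right_ne_zero_of_mul hne
  rw [poisson, Complex.ofReal_div, ← hD]
  generalize Complex.exp (x * Complex.I) = E at *
  generalize Complex.exp ((-x : ℝ) * Complex.I) = E' at *
  push_cast
  field_simp
  linear_combination (r : ℂ) ^ 2 * h

theorem hasSum_conjPoisson {r : ℝ} (hr : 0 ≤ r) (hr1 : r < 1) (x : ℝ) :
    HasSum (fun n : ℤ => (-Complex.I * n.sign) * (r : ℂ) ^ n.natAbs * fourier n (x : Torus))
      (conjPoisson r x : ℂ) := by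
  obtain ⟨h1, h2⟩ := hasSum_geometric_pair hr hr1 x
  have h1' : HasSum (fun n : ℕ => (-Complex.I * (n : ℤ).sign) * (r : ℂ) ^ (n : ℤ).natAbs *
      fourier (n : ℤ) (x : Torus))
      (-Complex.I * ((1 - (r : ℂ) * Complex.exp (x * Complex.I))⁻¹ - 1)) := by
    -- Since sign 0 = 0, the constant term 1 is removed from the geometric series.
    refine ((h1.sub (hasSum_ite_eq 0 1)).mul_left (-Complex.I)).congr_fun fun n => ?_
    rcases n with _ | n
    · simp
    · have : ((n + 1 : ℕ) : ℤ).sign = 1 := Int.sign_eq_one_of_pos (by positivity)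
      rw [this, Int.natAbs_natCast, if_neg (by omega)]
      simp
      ring
  have h2' : HasSum (fun n : ℕ => (-Complex.I * (-((n : ℤ) + 1)).sign) *
      (r : ℂ) ^ (-((n : ℤ) + 1)).natAbs * fourier (-((n : ℤ) + 1)) (x : Torus))
      (Complex.I * ((r : ℂ) * Complex.exp ((-x : ℝ) * Complex.I) *
        (1 - (r : ℂ) * Complex.exp ((-x : ℝ) * Complex.I))⁻¹)) := by
    refine (h2.mul_left Complex.I).congr_fun fun n => ?_
    have e1 : (-((n : ℤ) + 1)).sign = -1 := Int.sign_eq_neg_one_of_neg (by omega)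
    have e2 : (-((n : ℤ) + 1)).natAbs = n + 1 := by omega
    rw [e1, e2]
    push_cast
    ring
  have key := HasSum.of_nat_of_neg_add_one
    (f := fun n : ℤ => (-Complex.I * n.sign) * (r : ℂ) ^ n.natAbs * fourier n (x : Torus)) h1' h2'
  convert key using 1
  have hD := one_sub_mul_exp_mul r x
  have hpos : 0 < 1 - 2 * r * cos x + r ^ 2 :=
    lt_of_lt_of_le (by have := sub_pos.2 hr1; positivity) (sq_one_sub_le hr x)
  have hne : ((1 - 2 * r * cos x + r ^ 2 : ℝ) : ℂ) ≠ 0 := by exact_mod_cast hpos.ne'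
  have h : Complex.sin x = (Complex.exp ((-x : ℝ) * Complex.I) - Complex.exp (x * Complex.I))
      * Complex.I / 2 := by
    rw [Complex.sin]; push_cast; ring_nf
  rw [← hD] at hne
  have ha := left_ne_zero_of_mul hne
  have hb := right_ne_zero_of_mul hne
  rw [conjPoisson, Complex.ofReal_div, ← hD]
  rw [Complex.ofReal_mul, Complex.ofReal_sin, h]
  generalize Complex.exp (x * Complex.I) = E at *
  generalize Complex.exp ((-x : ℝ) * Complex.I) = E' at *
  push_cast
  field_simp
  ring

/-- Absolute summability permits termwise integration. The factor 2π reflects that `fourierCoeff`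
uses the normalized measure. -/
theorem hasSum_integral_fourier {c : ℤ → ℂ} (hc : Summable fun n => ‖c n‖) {K : ℝ → ℂ}
    (hK : ∀ x : ℝ, HasSum (fun n => c n * fourier n (x : Torus)) (K x)) {g : Torus → ℂ}
    (α : ℝ)
    (hi : IntegrableOn (fun β : ℝ => g (β : Torus)) (period α)) :
    HasSum (fun n => c n * fourier n (α : Torus) * ((2 * π : ℝ) * fourierCoeff g n))
      (∫ β in period α, K (α - β) * g (β : Torus)) := by
  have hp := Real.pi_pos
  have hcont : ∀ n : ℤ, Continuous fun β : ℝ => c n * fourier n ((α - β : ℝ) : Torus) := fun n =>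
    continuous_const.mul ((fourier n).continuous.comp
      ((AddCircle.continuous_mk' _).comp (by fun_prop)))
  have hn : ∀ (n : ℤ) (β : ℝ), ‖c n * fourier n ((α - β : ℝ) : Torus)‖ = ‖c n‖ := by
    intro n β
    rw [norm_mul, fourier_coe_torus, norm_zpow, Complex.norm_exp_ofReal_mul_I, one_zpow, mul_one]
  have h1 := hasSum_integral_of_summable_integral_norm (μ := volume.restrict (period α))
    (F := fun (n : ℤ) (β : ℝ) => c n * fourier n ((α - β : ℝ) : Torus) * g (β : Torus))
    (fun n => hi.bdd_mul (hcont n).aestronglyMeasurable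
      (Eventually.of_forall fun β => (hn n β).le))
    (by
      have hn' : ∀ (n : ℤ) (β : ℝ), ‖c n * fourier n ((α - β : ℝ) : Torus) * g (β : Torus)‖
          = ‖c n‖ * ‖g (β : Torus)‖ := fun n β => by rw [norm_mul, hn]
      simp only [hn', integral_const_mul]
      exact hc.mul_right _)
  have e1 : ∀ β : ℝ, ∑' n : ℤ, c n * fourier n ((α - β : ℝ) : Torus) * g (β : Torus)
      = K (α - β) * g (β : Torus) := fun β => ((hK (α - β)).mul_right _).tsum_eq
  simp only [e1] at h1
  refine h1.congr_fun fun n => ?_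
  rw [fourierCoeff_eq_intervalIntegral g n (α - π), show α - π + 2 * π = α + π by ring,
    intervalIntegral.integral_of_le (by linarith), integral_Ioc_eq_integral_Ioo, ← period_eq]
  have e2 : ∀ β : ℝ, c n * fourier n ((α - β : ℝ) : Torus) * g (β : Torus)
      = (c n * fourier n (α : Torus)) * (fourier (-n) (β : Torus) • g (β : Torus)) := by
    intro β
    have e3 : (fourier n ((α - β : ℝ) : Torus) : ℂ)
        = fourier n (α : Torus) * fourier (-n) (β : Torus) := by
      rw [fourier_coe_torus, fourier_coe_torus, fourier_coe_torus, zpow_neg, ← inv_zpow,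
        ← mul_zpow, ← Complex.exp_neg, ← Complex.exp_add]
      congr 2
      push_cast
      ring
    rw [e3, smul_eq_mul]
    ring
  simp only [e2]
  rw [integral_const_mul, Complex.real_smul, ← mul_assoc (((2 * π : ℝ) : ℂ)), ← Complex.ofReal_mul,
    mul_one_div_cancel (by positivity), Complex.ofReal_one, one_mul]

/-! ### Almost everywhere existence of the conjugate function -/

/-- The denominator is ε² + 2(1 - ε)(1 - cos x), with 2(1 - ε) ≥ 1; and 1 - cos x ≥ 2x²/π² with 2/π²
≥ 1/5. -/
theorem poisson_denom_lower {ε x : ℝ} (hε : 0 < ε) (hε2 : ε ≤ 1 / 2) (hx : |x| < π) :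
    (ε ^ 2 + x ^ 2) / 5 ≤ 1 - 2 * (1 - ε) * cos x + (1 - ε) ^ 2 ∧ x ^ 2 / 5 ≤ 1 - cos x := by
  have h1 := Real.cos_le_one_sub_mul_cos_sq hx.le
  have h2 : 1 / 5 ≤ 2 / π ^ 2 := by
    rw [div_le_div_iff₀ (by norm_num) (by positivity)]
    nlinarith [Real.pi_lt_d2, Real.pi_pos]
  have h3 : x ^ 2 / 5 ≤ 1 - cos x := by nlinarith [sq_nonneg x]
  refine ⟨?_, h3⟩
  have h4 : 0 ≤ 1 - cos x := by linarith [Real.cos_le_one x]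
  nlinarith [sq_nonneg ε]

theorem abs_poisson_le {ε x : ℝ} (hε : 0 < ε) (hε2 : ε ≤ 1 / 2) (hx : |x| < π) :
    |poisson (1 - ε) x| ≤ 25 * profile ε x := by
  obtain ⟨h1, -⟩ := poisson_denom_lower hε hε2 hx
  have hp : 0 < (ε ^ 2 + x ^ 2) / 5 := by positivity
  have hn : 0 ≤ 1 - (1 - ε) ^ 2 := by nlinarith
  rw [poisson, profile, abs_div, abs_of_nonneg hn, abs_of_pos (hp.trans_le h1)]
  calc _ ≤ (2 * ε) / ((ε ^ 2 + x ^ 2) / 5) := by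
        gcongr
        nlinarith
    _ = 10 * (ε / (ε ^ 2 + x ^ 2)) := by field_simp; norm_num
    _ ≤ _ := by gcongr; norm_num

/-- The truncated kernel `cot (x / 2)`. -/
def truncCot (ε x : ℝ) : ℝ := if ε < |x| then cos (x / 2) / sin (x / 2) else 0

theorem cot_half_eq {x : ℝ} (h : 1 - cos x ≠ 0) :
    cos (x / 2) / sin (x / 2) = sin x / (1 - cos x) := by
  have e1 : cos x = 2 * cos (x / 2) ^ 2 - 1 := by rw [← Real.cos_two_mul]; ring_nf
  have e2 : sin x = 2 * sin (x / 2) * cos (x / 2) := by rw [← Real.sin_two_mul]; ring_nf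
  have e3 : 1 - cos x = 2 * sin (x / 2) ^ 2 := by
    rw [e1]; linarith [Real.sin_sq_add_cos_sq (x / 2)]
  have hs : sin (x / 2) ≠ 0 := by
    intro hs
    rw [hs] at e3
    exact h (by rw [e3]; ring)
  rw [e3, e2]
  field_simp

/-- Truncating at distance ε and smoothing with r = 1 - ε differ by an approximate-identity error.
Outside the cut the numerator of the difference collapses to -ε² sin x; inside, the conjugate
Poisson kernel alone is small enough. -/
theorem abs_conjPoisson_sub_le {ε x : ℝ} (hε : 0 < ε) (hε2 : ε ≤ 1 / 2) (hx : |x| < π) :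
    |conjPoisson (1 - ε) x - truncCot ε x| ≤ 25 * profile ε x := by
  obtain ⟨h1, h2⟩ := poisson_denom_lower hε hε2 hx
  have hp : 0 < (ε ^ 2 + x ^ 2) / 5 := by positivity
  have hD := hp.trans_le h1
  have hs := Real.abs_sin_le_abs (x := x)
  unfold truncCot
  split_ifs with h
  · have hx0 : 0 < |x| := hε.trans h
    have hx2 : 0 < x ^ 2 / 5 := by have := abs_pos.1 hx0; positivity
    have hc : 0 < 1 - cos x := hx2.trans_le h2
    rw [cot_half_eq hc.ne', conjPoisson]
    have e : 2 * (1 - ε) * sin x / (1 - 2 * (1 - ε) * cos x + (1 - ε) ^ 2) - sin x / (1 - cos x)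
        = -(sin x * ε ^ 2) / ((1 - 2 * (1 - ε) * cos x + (1 - ε) ^ 2) * (1 - cos x)) := by
      field_simp
      ring
    rw [e, abs_div, abs_neg, abs_mul, abs_of_pos (mul_pos hD hc), abs_of_nonneg (sq_nonneg ε),
      profile]
    calc _ ≤ |x| * ε ^ 2 / ((ε ^ 2 + x ^ 2) / 5 * (x ^ 2 / 5)) := by gcongr
      _ = 25 * (ε / (ε ^ 2 + x ^ 2)) * (ε / |x|) := by
        rw [← sq_abs x]; field_simp; norm_num
      _ ≤ 25 * (ε / (ε ^ 2 + x ^ 2)) * 1 := by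
        gcongr
        exact (div_le_one hx0).2 h.le
      _ = _ := mul_one _
  · push Not at h
    rw [sub_zero, conjPoisson, abs_div, abs_of_pos hD, abs_mul, abs_of_pos (by linarith), profile]
    calc _ ≤ 2 * 1 * ε / ((ε ^ 2 + x ^ 2) / 5) := by
          gcongr
          · linarith
          · exact hs.trans h
      _ = 10 * (ε / (ε ^ 2 + x ^ 2)) := by field_simp; norm_num
      _ ≤ _ := by gcongr; norm_num

theorem continuous_poisson {r : ℝ} (hr : 0 ≤ r) (hr1 : r < 1) : Continuous (poisson r) := by
  unfold poisson
  refine continuous_const.div (by fun_prop) fun x => ?_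
  exact (lt_of_lt_of_le (by have := sub_pos.2 hr1; positivity) (sq_one_sub_le hr x)).ne'

theorem continuous_conjPoisson {r : ℝ} (hr : 0 ≤ r) (hr1 : r < 1) : Continuous (conjPoisson r) := by
  unfold conjPoisson
  refine Continuous.div (by fun_prop) (by fun_prop) fun x => ?_
  exact (lt_of_lt_of_le (by have := sub_pos.2 hr1; positivity) (sq_one_sub_le hr x)).ne'

theorem measurable_truncCot (ε : ℝ) : Measurable (truncCot ε) := by
  unfold truncCot
  exact Measurable.ite (measurableSet_lt measurable_const (by fun_prop)) (by fun_prop) (by fun_prop)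

theorem abs_cot_half_le {x : ℝ} (hx0 : x ≠ 0) (hx : |x| < π) :
    |cos (x / 2) / sin (x / 2)| ≤ 5 / |x| := by
  have h2 := (poisson_denom_lower (ε := 1 / 2) (by norm_num) le_rfl hx).2
  have hx2 : 0 < x ^ 2 / 5 := by positivity
  have hc : 0 < 1 - cos x := hx2.trans_le h2
  rw [cot_half_eq hc.ne', abs_div, abs_of_pos hc]
  calc _ ≤ |x| / (x ^ 2 / 5) := div_le_div₀ (abs_nonneg _) Real.abs_sin_le_abs hx2 h2
    _ = 5 / |x| := by
      have := abs_pos.2 hx0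
      rw [← sq_abs x]; field_simp

theorem abs_truncCot_le {ε x : ℝ} (hε : 0 < ε) (hx : |x| < π) : |truncCot ε x| ≤ 5 / ε := by
  unfold truncCot
  split_ifs with h
  · refine (abs_cot_half_le (abs_pos.1 (hε.trans h)) hx).trans ?_
    gcongr
  · simp; positivity

theorem integral_period_odd {k : ℝ → ℝ} (hk : ∀ x, k (-x) = -k x) (α : ℝ) :
    ∫ β in period α, (k (α - β) : ℂ) = 0 := by
  rw [← integral_indicator (measurableSet_period α)]
  let G : ℝ → ℂ := fun h => if |h| < π then (k h : ℂ) else 0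
  have e : (period α).indicator (fun β => (k (α - β) : ℂ)) = fun β => G (α - β) := by
    funext β
    by_cases hβ : |α - β| < π
    · rw [Set.indicator_of_mem (show β ∈ period α from hβ)]
      simp only [G, if_pos hβ]
    · rw [Set.indicator_of_notMem (show β ∉ period α from hβ)]
      simp only [G, if_neg hβ]
  have e2 : ∀ h, G (-h) = -G h := by
    intro h
    simp only [G, abs_neg, hk]
    split_ifs <;> simp
  rw [e, integral_sub_left_eq_self G volume α]
  have h1 : ∫ h, G (-h) = ∫ h, G h := integral_neg_eq_self G volume
  simp only [e2] at h1
  rw [integral_neg] at h1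
  exact self_eq_neg.1 h1.symm

theorem conjPoisson_neg (r x : ℝ) : conjPoisson r (-x) = -conjPoisson r x := by
  simp only [conjPoisson, cos_neg, sin_neg]; ring

theorem truncCot_neg (ε x : ℝ) : truncCot ε (-x) = -truncCot ε x := by
  simp only [truncCot, abs_neg, neg_div, cos_neg, sin_neg, div_neg]
  split_ifs <;> simp

theorem integrableOn_period_bdd_mul {k : ℝ → ℝ} (hk : Measurable k) {C : ℝ}
    (hC : ∀ x, |x| < π → |k x| ≤ C) {f : ℝ → ℂ} {α : ℝ} (hf : IntegrableOn f (period α)) :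
    IntegrableOn (fun β => (k (α - β) : ℂ) * f β) (period α) := by
  refine Integrable.bdd_mul hf (c := C) ?_ ?_
  · exact (Complex.measurable_ofReal.comp (hk.comp (by fun_prop))).aestronglyMeasurable
  · refine (ae_restrict_iff' (measurableSet_period α)).2 (Eventually.of_forall fun β hβ => ?_)
    rw [Complex.norm_real]
    exact hC _ hβ

theorem integral_period_kernel_sub {k : ℝ → ℝ} (hk : Measurable k) {C : ℝ}
    (hC : ∀ x, |x| < π → |k x| ≤ C) {f : ℝ → ℂ} {α : ℝ} (hf : IntegrableOn f (period α)) :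
    ∫ β in period α, (k (α - β) : ℂ) * (f β - f α)
      = (∫ β in period α, (k (α - β) : ℂ) * f β) - (∫ β in period α, (k (α - β) : ℂ)) * f α := by
  have h1 := integrableOn_period_bdd_mul hk hC hf
  have h2 := integrableOn_period_bdd_mul hk hC (f := fun _ => f α) (α := α)
    (integrableOn_const (volume_period_ne_top α))
  simp only [mul_sub]
  rw [integral_sub h1 h2, integral_mul_const]

/-- The conjugate function is built by Parseval: the multipliers -i sgn(n) have modulus at most 1
and preserve square summability. -/
theorem exists_conjugate (u : L2) : ∃ g : Torus → ℂ, Measurable g ∧ Integrable g ∧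
    ∀ n : ℤ, fourierCoeff g n = -Complex.I * n.sign * fourierCoeff (fun a => (u a : ℂ)) n := by
  have hu : MemLp (fun a => (u a : ℂ)) 2 (AddCircle.haarAddCircle (T := 2 * π)) :=
    (memLp_haarAddCircle_iff (f := fun a => (u a : ℂ))).2 (Lp.memLp u).ofReal
  have hc : ∀ n, (fourierBasis (T := 2 * π)).repr hu.toLp n = fourierCoeff (fun a => (u a : ℂ)) n := by
    intro n
    rw [fourierBasis_repr, fourierCoeff_congr_ae (T := 2 * π) hu.coeFn_toLp]
  have hmem : Memℓp (fun n : ℤ => -Complex.I * n.sign * (fourierBasis (T := 2 * π)).repr hu.toLp n) 2 := by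
    refine memℓp_gen ?_
    refine Summable.of_nonneg_of_le (fun _ => by positivity) (fun n => ?_)
      ((lp.memℓp ((fourierBasis (T := 2 * π)).repr hu.toLp)).summable (by norm_num))
    gcongr
    rw [norm_mul, norm_mul, norm_neg, Complex.norm_I, one_mul]
    refine mul_le_of_le_one_left (norm_nonneg _) ?_
    rcases lt_trichotomy n 0 with h | h | h
    · simp [Int.sign_eq_neg_one_of_neg h]
    · simp [h]
    · simp [Int.sign_eq_one_of_pos h]
  let v : lp (fun _ : ℤ => ℂ) 2 := ⟨_, hmem⟩
  let g := (fourierBasis (T := 2 * π)).repr.symm v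
  refine ⟨g, (Lp.stronglyMeasurable g).measurable, ?_, fun n => ?_⟩
  · exact (memLp_haarAddCircle_iff.1 (Lp.memLp g)).integrable (by norm_num)
  · rw [← fourierBasis_repr, LinearIsometryEquiv.apply_symm_apply, ← hc]

theorem locallyIntegrable_comp_coe {g : Torus → ℂ} (hg : Integrable g) :
    LocallyIntegrable fun β : ℝ => g (β : Torus) := by
  intro x
  refine ⟨Set.Ioc (x - π) (x - π + 2 * π), ?_, ?_⟩
  · exact Ioc_mem_nhds (by linarith [Real.pi_pos]) (by linarith [Real.pi_pos])
  · exact (AddCircle.measurePreserving_mk (2 * π) (x - π)).integrable_comp_of_integrable hg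

theorem integrableOn_period_comp_coe {g : Torus → ℂ} (hg : Integrable g) (α : ℝ) :
    IntegrableOn (fun β : ℝ => g (β : Torus)) (period α) := by
  rw [period_eq]
  exact ((locallyIntegrable_comp_coe hg).integrableOn_isCompact isCompact_Icc).mono_set
    Set.Ioo_subset_Icc_self

theorem summable_poisson_coeff {r : ℝ} (hr : 0 ≤ r) (hr1 : r < 1) :
    Summable fun n : ℤ => r ^ n.natAbs := by
  refine Summable.of_nat_of_neg ?_ ?_ <;>
    simpa using summable_geometric_of_lt_one hr hr1

theorem integral_poisson {r : ℝ} (hr : 0 ≤ r) (hr1 : r < 1) (α : ℝ) :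
    ∫ β in period α, (poisson r (α - β) : ℂ) = (2 * π : ℝ) := by
  have h := hasSum_integral_fourier (c := fun n => (r : ℂ) ^ n.natAbs)
    (by simpa [abs_of_nonneg hr] using summable_poisson_coeff hr hr1)
    (K := fun x => (poisson r x : ℂ))
    (fun x => hasSum_poisson hr hr1 x) (g := fourier 0) α
    (by simpa using integrableOn_const (C := (1 : ℂ)) (volume_period_ne_top α))
  simp only [fourierCoeff_fourier, fourier_zero, mul_one] at h
  refine h.unique ?_
  convert hasSum_single (0 : ℤ) ?_ using 1
  · simp
  · intro n hn
    simp [hn]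

theorem integral_conjPoisson_eq {u g : Torus → ℂ}
    (hg : ∀ n : ℤ, fourierCoeff g n = -Complex.I * n.sign * fourierCoeff u n)
    (hui : Integrable u) (hgi : Integrable g) {r : ℝ} (hr : 0 ≤ r) (hr1 : r < 1) (α : ℝ) :
    ∫ β in period α, (conjPoisson r (α - β) : ℂ) * u (β : Torus)
      = ∫ β in period α, (poisson r (α - β) : ℂ) * g (β : Torus) := by
  have h1 := hasSum_integral_fourier (c := fun n => (r : ℂ) ^ n.natAbs)
    (by simpa [abs_of_nonneg hr] using summable_poisson_coeff hr hr1)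
    (K := fun x => (poisson r x : ℂ))
    (fun x => hasSum_poisson hr hr1 x) α (integrableOn_period_comp_coe hgi α)
  have h2 := hasSum_integral_fourier
    (c := fun n : ℤ => (-Complex.I * n.sign) * (r : ℂ) ^ n.natAbs)
    (by
      refine Summable.of_nonneg_of_le (fun _ => norm_nonneg _) (fun n => ?_)
        (summable_poisson_coeff hr hr1)
      rw [norm_mul, norm_mul, norm_neg, Complex.norm_I, one_mul, norm_pow, Complex.norm_real,
        Real.norm_of_nonneg hr]
      refine mul_le_of_le_one_left (by positivity) ?_
      rcases lt_trichotomy n 0 with h | h | h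
      · simp [Int.sign_eq_neg_one_of_neg h]
      · simp [h]
      · simp [Int.sign_eq_one_of_pos h])
    (K := fun x => (conjPoisson r x : ℂ))
    (fun x => hasSum_conjPoisson hr hr1 x) α (integrableOn_period_comp_coe hui α)
  refine h2.unique (h1.congr_fun fun n => ?_)
  simp only [hg]
  ring

/-- The truncated integrals against `cot ((α - β) / 2)` converge almost everywhere. -/
theorem ae_exists_tendsto_truncCot (u : L2) : ∀ᵐ α : ℝ, ∃ l : ℝ,
    Tendsto (fun ε => ∫ β in period α, truncCot ε (α - β) * u (β : Torus)) (𝓝[>] 0) (𝓝 l) := by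
  obtain ⟨g, hgm, hgi, hg⟩ := exists_conjugate u
  have hui : Integrable fun a : Torus => (u a : ℂ) :=
    ((Lp.memLp u).integrable (by norm_num)).ofReal
  have hum : Measurable fun a : Torus => (u a : ℂ) :=
    Complex.measurable_ofReal.comp (Lp.stronglyMeasurable u).measurable
  have hmk : Measurable fun β : ℝ => (β : Torus) := (AddCircle.continuous_mk' _).measurable
  filter_upwards [ae_isLebesguePoint (locallyIntegrable_comp_coe hui),
    ae_isLebesguePoint (locallyIntegrable_comp_coe hgi)] with α hα hα'
  have hsmall : ∀ᶠ ε in 𝓝[>] (0 : ℝ), 0 < ε ∧ ε ≤ 1 / 2 := by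
    filter_upwards [Ioc_mem_nhdsGT (show (0 : ℝ) < 1 / 2 by norm_num)] with ε hε
    exact ⟨hε.1, hε.2⟩
  have hpb : ∀ ε : ℝ, 0 < ε → ∀ x, profile ε x ≤ 1 / ε := by
    intro ε hε x
    rw [profile, div_le_div_iff₀ (by positivity) hε]
    nlinarith [sq_nonneg x]
  have t1 := tendsto_integral_kernel_sub (f := fun β : ℝ => (u (β : Torus) : ℂ)) (hum.comp hmk)
    (locallyIntegrable_comp_coe hui) hα
    (k := fun ε x => conjPoisson (1 - ε) x - truncCot ε x) (A := 25)
    (hsmall.mono fun ε h x hx => abs_conjPoisson_sub_le h.1 h.2 hx)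
  have t2 := tendsto_integral_kernel_sub (f := fun β : ℝ => g (β : Torus)) (hgm.comp hmk)
    (locallyIntegrable_comp_coe hgi) hα'
    (k := fun ε x => poisson (1 - ε) x) (A := 25)
    (hsmall.mono fun ε h x hx => abs_poisson_le h.1 h.2 hx)
  -- With P, Q, T the Poisson, conjugate Poisson and truncated kernels: P has mass 2π, Q - T is odd,
  -- and ∫ Q u = ∫ P g. Hence this combination equals ∫ T u exactly.
  have t3 := ((t2.add_const ((2 * π : ℝ) * g (α : Torus))).sub t1)
  rw [zero_add, sub_zero] at t3
  have t4 : Tendsto (fun ε => ((∫ β in period α, truncCot ε (α - β) * u (β : Torus) : ℝ) : ℂ))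
      (𝓝[>] 0) (𝓝 ((2 * π : ℝ) * g (α : Torus))) := by
    refine t3.congr' ?_
    filter_upwards [hsmall] with ε hε
    have hr : 0 ≤ 1 - ε := by linarith
    have hr1 : 1 - ε < 1 := by linarith
    have mQ := (continuous_conjPoisson hr hr1).measurable
    have mT := measurable_truncCot ε
    have mk : Measurable fun x => conjPoisson (1 - ε) x - truncCot ε x := mQ.sub mT
    have bT : ∀ x, |x| < π → |truncCot ε x| ≤ 5 / ε := fun x hx => abs_truncCot_le hε.1 hx
    have bk : ∀ x, |x| < π → |conjPoisson (1 - ε) x - truncCot ε x| ≤ 25 * (1 / ε) := fun x hx =>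
      (abs_conjPoisson_sub_le hε.1 hε.2 hx).trans (by gcongr; exact hpb ε hε.1 x)
    have bQ : ∀ x, |x| < π → |conjPoisson (1 - ε) x| ≤ 25 * (1 / ε) + 5 / ε := by
      intro x hx
      have h1 := abs_add_le (conjPoisson (1 - ε) x - truncCot ε x) (truncCot ε x)
      rw [sub_add_cancel] at h1
      exact h1.trans (add_le_add (bk x hx) (bT x hx))
    have bP : ∀ x, |x| < π → |poisson (1 - ε) x| ≤ 25 * (1 / ε) := fun x hx =>
      (abs_poisson_le hε.1 hε.2 hx).trans (by gcongr; exact hpb ε hε.1 x)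
    have iu := integrableOn_period_comp_coe hui α
    have ig := integrableOn_period_comp_coe hgi α
    rw [integral_period_kernel_sub (continuous_poisson hr hr1).measurable bP ig,
      integral_period_kernel_sub mk bk iu, integral_poisson hr hr1,
      integral_period_odd (k := fun x => conjPoisson (1 - ε) x - truncCot ε x)
        (fun x => by rw [conjPoisson_neg, truncCot_neg]; ring) α, zero_mul, sub_zero,
      sub_add_cancel, ← integral_conjPoisson_eq hg hui hgi hr hr1, ← integral_sub
        (integrableOn_period_bdd_mul mQ bQ iu)
        (integrableOn_period_bdd_mul mk bk iu), ← integral_complex_ofReal]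
    refine integral_congr_ae (Eventually.of_forall fun β => ?_)
    push_cast
    ring
  -- The truncated integrals are real, so taking real parts avoids proving that g is real.
  refine ⟨((2 * π : ℝ) * g (α : Torus)).re, ?_⟩
  exact ((Complex.continuous_re.tendsto _).comp t4).congr fun ε => Complex.ofReal_re _

/-! ### The Birkhoff-Rott integral -/

theorem ae_real_of_ae_torus {p : Torus → Prop} (h : ∀ᵐ a : Torus, p a) :
    ∀ᵐ x : ℝ, p (x : Torus) := by
  have h1 : ∀ k : ℤ, ∀ᵐ x : ℝ, x ∈ Set.Ioc (k : ℝ) (k + 2 * π) → p (x : Torus) := fun k =>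
    (ae_restrict_iff' measurableSet_Ioc).1
      ((AddCircle.measurePreserving_mk (2 * π) (k : ℝ)).quasiMeasurePreserving.ae h)
  filter_upwards [ae_all_iff.2 h1] with x hx
  have h2 := Int.ceil_lt_add_one x
  have h3 := Int.le_ceil x
  refine hx (⌈x⌉ - 1) ⟨?_, ?_⟩
  · push_cast; linarith
  · push_cast; linarith [Real.pi_gt_three]

/-- The domain of the truncated integrals. -/
def truncPeriod (ε α : ℝ) : Set ℝ := {β | ε < |α - β| ∧ |α - β| < π}

theorem truncPeriod_subset (ε α : ℝ) : truncPeriod ε α ⊆ period α := fun _ h => h.2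

theorem measurableSet_truncPeriod (ε α : ℝ) : MeasurableSet (truncPeriod ε α) :=
  (measurableSet_lt measurable_const
    (show Measurable fun β : ℝ => |α - β| by fun_prop)).inter (measurableSet_period α)

theorem tendsto_integral_truncPeriod {E : Type*} [NormedAddCommGroup E] [NormedSpace ℝ E]
    {f : ℝ → E} {α : ℝ} (hf : IntegrableOn f (period α)) :
    Tendsto (fun ε => ∫ β in truncPeriod ε α, f β) (𝓝[>] 0) (𝓝 (∫ β in period α, f β)) := by
  simp only [← integral_indicator (measurableSet_truncPeriod _ α),
    ← integral_indicator (measurableSet_period α)]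
  have hf' : Integrable ((period α).indicator f) :=
    (integrable_indicator_iff (measurableSet_period α)).2 hf
  refine tendsto_integral_filter_of_dominated_convergence (fun β => ‖(period α).indicator f β‖)
    (Eventually.of_forall fun ε => ?_) (Eventually.of_forall fun ε => ?_) hf'.norm ?_
  · exact ((integrable_indicator_iff (measurableSet_truncPeriod ε α)).2
      (hf.mono_set (truncPeriod_subset ε α))).aestronglyMeasurable
  · exact Eventually.of_forall fun β =>
      norm_indicator_le_of_subset (truncPeriod_subset ε α) f β
  · filter_upwards [Measure.ae_ne volume α] with β hβ
    have h0 : 0 < |α - β| := abs_pos.2 (sub_ne_zero.2 hβ.symm)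
    refine tendsto_const_nhds.congr' ?_
    filter_upwards [Ioo_mem_nhdsGT h0] with ε hε
    by_cases h : β ∈ period α
    · rw [Set.indicator_of_mem h, Set.indicator_of_mem (show β ∈ truncPeriod ε α from ⟨hε.2, h⟩)]
    · rw [Set.indicator_of_notMem h,
        Set.indicator_of_notMem fun h' => h (truncPeriod_subset ε α h')]

/-- Multiply numerator and denominator by the sine of the conjugate: product-to-sum gives (sin x - i
sinh y)/2 over |sin|² = (cosh y - cos x)/2. Where the sine vanishes both sides are zero by
convention, so no hypothesis is needed. -/
theorem cos_div_sin_eq_kernel (x y : ℝ) :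
    Complex.cos ((x + y * Complex.I) / 2) / Complex.sin ((x + y * Complex.I) / 2)
      = kernel₂ x y - kernel₁ x y * Complex.I := by
  have hv : ((x : ℂ) + y * Complex.I) / 2 = ((x / 2 : ℝ) : ℂ) + ((y / 2 : ℝ) : ℂ) * Complex.I := by
    push_cast; ring
  have hD : cosh y - cos x = 2 * Complex.normSq (Complex.sin ((x + y * Complex.I) / 2)) := by
    rw [hv, ← Complex.sq_norm, normSq_sin_add_mul_I, cosh_sub_cos_eq]
  have hconj : (starRingEnd ℂ) (((x : ℂ) + y * Complex.I) / 2) = (x - y * Complex.I) / 2 := by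
    rw [map_div₀, map_add, map_mul, Complex.conj_ofReal, Complex.conj_ofReal, Complex.conj_I,
      map_ofNat]
    ring
  have hnum : 2 * (Complex.cos ((x + y * Complex.I) / 2) * Complex.sin ((x - y * Complex.I) / 2))
      = Complex.sin x - Complex.sinh y * Complex.I := by
    have h1 : (x : ℂ) = (x + y * Complex.I) / 2 + (x - y * Complex.I) / 2 := by ring
    have h2 : (y : ℂ) * Complex.I = (x + y * Complex.I) / 2 - (x - y * Complex.I) / 2 := by ring
    rw [← Complex.sin_mul_I]
    conv_rhs => rw [h2]
    conv_rhs => enter [1]; rw [h1]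
    rw [Complex.sin_add, Complex.sin_sub]
    ring
  rw [kernel₁_eq, kernel₂_eq, hD, div_eq_mul_inv, Complex.inv_def, ← Complex.sin_conj, hconj,
    ← mul_assoc]
  push_cast
  rw [← sub_eq_zero]
  have h3 : Complex.cos ((x + y * Complex.I) / 2) * Complex.sin ((x - y * Complex.I) / 2)
      = (Complex.sin x - Complex.sinh y * Complex.I) / 2 := by rw [← hnum]; ring
  rw [h3]
  generalize ((Complex.normSq (Complex.sin ((x + y * Complex.I) / 2)) : ℝ) : ℂ) = N
  rw [div_eq_mul_inv _ (2 * N), div_eq_mul_inv _ (2 * N), mul_inv]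
  ring

theorem norm_half_cot_sub_le {h : ℝ} (hh : |h| ≤ 1) (h0 : h ≠ 0) :
    ‖((cos (h / 2) / sin (h / 2) : ℝ) : ℂ) - 2 / (h : ℂ)‖ ≤ 2 := by
  have h1 : ‖((h : ℂ) / 2)‖ ≤ 1 / 2 := by
    rw [norm_div, Complex.norm_real, Complex.norm_two, Real.norm_eq_abs]; linarith
  have h2 := norm_cot_sub_inv_le h1 (div_ne_zero (by exact_mod_cast h0) two_ne_zero)
  rw [one_div_div] at h2
  push_cast
  exact h2

/-! ### Principal values along the curve. -/

namespace IsChordArc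

variable {δ M B : ℝ} {ζ ζ₁ ζ₂ : ℝ → ℂ}

/-- Both kernels have the same singular part 2/(α - β), so existence of principal values transfers
from the flat curve to ζ. -/
theorem norm_cotKernel_sub_cot_le (H : IsChordArc δ M B ζ ζ₁ ζ₂) {α β : ℝ} (h : |α - β| < π) :
    ‖cotKernel ζ ζ₁ α β - ((cos ((α - β) / 2) / sin ((α - β) / 2) : ℝ) : ℂ)‖
      ≤ 4 * B * M ^ 2 + 5 * M := by
  have hM := H.one_le_M
  have hM0 := H.M_pos
  have hB := H.B_pos
  rcases eq_or_ne α β with rfl | h0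
  · rw [cotKernel_self]
    simp
    positivity
  have hne := sub_ne_zero.2 h0
  have hp := abs_pos.2 hne
  rcases le_total (M * |α - β|) 1 with h1 | h1
  · have h2 := H.norm_cotKernel_sub_le_of_near h1 h0
    have h3 := norm_half_cot_sub_le (h := α - β) (by nlinarith) hne
    have h4 := norm_sub_le (cotKernel ζ ζ₁ α β - 2 / ((α - β : ℝ) : ℂ))
      (((cos ((α - β) / 2) / sin ((α - β) / 2) : ℝ) : ℂ) - 2 / ((α - β : ℝ) : ℂ))
    rw [sub_sub_sub_cancel_right] at h4
    have h5 : B * M ≤ B * M ^ 2 := by gcongr; nlinarith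
    linarith
  · refine (norm_sub_le _ _).trans (add_le_add ?_ ?_)
    · unfold cotKernel
      rw [norm_mul]
      have h2 : B / |α - β| ≤ B * M := by rw [div_le_iff₀ hp]; nlinarith
      calc _ ≤ B * M * M := by
            have := H.norm₁ α
            gcongr
            exact (H.norm_cot_le h.le h0).trans h2
        _ ≤ _ := by nlinarith [mul_pos hB (mul_pos hM0 hM0)]
    · rw [Complex.norm_real, Real.norm_eq_abs]
      refine (abs_cot_half_le hne h).trans ?_
      rw [div_le_iff₀ hp]
      nlinarith

theorem integrable_cotKernel_mul (H : IsChordArc δ M B ζ ζ₁ ζ₂) {u : ℝ → ℝ} {ε α : ℝ} (hε : 0 < ε)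
    (hu : IntegrableOn (fun β => (u β : ℂ)) (period α)) :
    IntegrableOn (fun β => u β * (Complex.cos ((ζ α - ζ β) / 2) / Complex.sin ((ζ α - ζ β) / 2)))
      (truncPeriod ε α) := by
  have hm := H.continuous.measurable
  refine Integrable.mul_bdd (c := B / ε) (hu.mono_set (truncPeriod_subset ε α))
    (Measurable.aestronglyMeasurable (by fun_prop)) ?_
  refine (ae_restrict_iff' (measurableSet_truncPeriod ε α)).2 (Eventually.of_forall fun β hβ => ?_)
  have h0 : α ≠ β := by
    rintro rfl
    have := hβ.1
    simp at this
    linarith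
  refine (H.norm_cot_le hβ.2.le h0).trans ?_
  have := H.B_pos
  gcongr
  exact hβ.1.le

/-- The truncated integrals of the complex kernel converge wherever those of the cotangent do. -/
theorem exists_tendsto_cot (H : IsChordArc δ M B ζ ζ₁ ζ₂) {u : ℝ → ℝ} {α : ℝ}
    (hu : IntegrableOn (fun β => (u β : ℂ)) (period α)) {l : ℝ}
    (hl : Tendsto (fun ε => ∫ β in period α, truncCot ε (α - β) * u β) (𝓝[>] 0) (𝓝 l)) :
    ∃ L : ℂ, Tendsto (fun ε => ∫ β in truncPeriod ε α,
      (u β : ℂ) * (Complex.cos ((ζ α - ζ β) / 2) / Complex.sin ((ζ α - ζ β) / 2)))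
      (𝓝[>] 0) (𝓝 L) := by
  have hm := H.continuous.measurable
  have hRm : Measurable fun β => cotKernel ζ ζ₁ α β -
      ((cos ((α - β) / 2) / sin ((α - β) / 2) : ℝ) : ℂ) := by
    unfold cotKernel
    fun_prop
  have hR : IntegrableOn (fun β => (u β : ℂ) * (cotKernel ζ ζ₁ α β -
      ((cos ((α - β) / 2) / sin ((α - β) / 2) : ℝ) : ℂ))) (period α) :=
    Integrable.mul_bdd (c := 4 * B * M ^ 2 + 5 * M) hu hRm.aestronglyMeasurable
      ((ae_restrict_iff' (measurableSet_period α)).2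
        (Eventually.of_forall fun β hβ => H.norm_cotKernel_sub_cot_le hβ))
  have t1 := tendsto_integral_truncPeriod hR
  have t2 := (Complex.continuous_ofReal.tendsto l).comp hl
  -- The comparison is for the kernel multiplied by ζ₁(α), which is constant in β and nonzero, and
  -- is divided out.
  refine ⟨_, ((t1.add t2).mul_const (ζ₁ α)⁻¹).congr' ?_⟩
  filter_upwards [self_mem_nhdsWithin] with ε hε
  have hε' : 0 < ε := hε
  have i1 := H.integrable_cotKernel_mul hε' hu
  have e1 : ((∫ β in period α, truncCot ε (α - β) * u β : ℝ) : ℂ)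
      = ∫ β in truncPeriod ε α, (u β : ℂ) * ((cos ((α - β) / 2) / sin ((α - β) / 2) : ℝ) : ℂ) := by
    rw [← integral_complex_ofReal, ← integral_indicator (measurableSet_period α),
      ← integral_indicator (measurableSet_truncPeriod ε α)]
    congr 1
    funext β
    by_cases h : β ∈ period α
    · by_cases h2 : ε < |α - β|
      · rw [Set.indicator_of_mem h, Set.indicator_of_mem (show β ∈ truncPeriod ε α from ⟨h2, h⟩),
          truncCot, if_pos h2]
        push_cast
        ring
      · rw [Set.indicator_of_mem h, Set.indicator_of_notMem (fun h' => h2 h'.1), truncCot,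
          if_neg h2]
        simp
    · rw [Set.indicator_of_notMem h,
        Set.indicator_of_notMem fun h' => h (truncPeriod_subset ε α h')]
  have i2 : IntegrableOn (fun β => (u β : ℂ) * ((cos ((α - β) / 2) / sin ((α - β) / 2) : ℝ) : ℂ))
      (truncPeriod ε α) := by
    refine ((i1.mul_const (ζ₁ α)).sub (hR.mono_set (truncPeriod_subset ε α))).congr
      (Eventually.of_forall fun β => ?_)
    simp only [Pi.sub_apply, cotKernel]
    ring
  simp only [Function.comp_apply]
  rw [e1, ← integral_add (hR.mono_set (truncPeriod_subset ε α)) i2, ← integral_mul_const]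
  refine integral_congr_ae (Eventually.of_forall fun β => ?_)
  have := H.ne_zero α
  simp only [cotKernel]
  field_simp
  ring

/-- After multiplication by the tangent the imaginary part is bounded, so its principal value is an
ordinary integral. This identifies T with the integral operator. -/
theorem tendsto_im_cotKernel_mul (H : IsChordArc δ M B ζ ζ₁ ζ₂) {u : ℝ → ℝ} {α : ℝ}
    (hu : IntegrableOn (fun β => (u β : ℂ)) (period α)) {L : ℂ}
    (hL : Tendsto (fun ε => ∫ β in truncPeriod ε α,
      (u β : ℂ) * (Complex.cos ((ζ α - ζ β) / 2) / Complex.sin ((ζ α - ζ β) / 2)))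
      (𝓝[>] 0) (𝓝 L)) :
    (L * ζ₁ α).im = ∫ β in period α, (cotKernel ζ ζ₁ α β).im * u β := by
  have hm := H.continuous.measurable
  have hur : IntegrableOn u (period α) := hu.re
  have hi : IntegrableOn (fun β => (cotKernel ζ ζ₁ α β).im * u β) (period α) := by
    refine Integrable.bdd_mul (c := 4 * B * M ^ 2) hur ?_
      ((ae_restrict_iff' (measurableSet_period α)).2 (Eventually.of_forall fun β hβ => ?_))
    · exact (H.measurable_cotKernel.comp measurable_prodMk_left).aestronglyMeasurable
    · rcases eq_or_ne α β with rfl | h0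
      · rw [cotKernel_self]
        have := H.B_pos
        simp
        positivity
      · exact H.abs_im_cotKernel_le (le_of_lt hβ) h0
  have t1 := (Complex.continuous_im.tendsto _).comp (hL.mul_const (ζ₁ α))
  refine tendsto_nhds_unique (t1.congr' ?_) (tendsto_integral_truncPeriod hi)
  filter_upwards [self_mem_nhdsWithin] with ε hε
  have i1 := (H.integrable_cotKernel_mul hε hu).mul_const (ζ₁ α)
  simp only [Function.comp_apply]
  rw [← integral_mul_const]
  have e := Complex.imCLM.integral_comp_comm i1
  simp only [Complex.imCLM_apply] at e
  rw [← e]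
  refine integral_congr_ae (Eventually.of_forall fun β => ?_)
  simp only [cotKernel]
  rw [mul_assoc, Complex.im_ofReal_mul, mul_comm]

end IsChordArc

theorem hasBR_of_tendsto {z : ℝ → Plane} {u : Torus → ℝ} {α : ℝ} {L : ℂ}
    (hi : ∀ ε > 0, IntegrableOn (fun β : ℝ => (u (β : Torus) : ℂ) *
      (Complex.cos ((toComplex (z α) - toComplex (z β)) / 2) /
        Complex.sin ((toComplex (z α) - toComplex (z β)) / 2))) (truncPeriod ε α))
    (hL : Tendsto (fun ε => ∫ β in truncPeriod ε α, (u (β : Torus) : ℂ) *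
      (Complex.cos ((toComplex (z α) - toComplex (z β)) / 2) /
        Complex.sin ((toComplex (z α) - toComplex (z β)) / 2))) (𝓝[>] 0) (𝓝 L)) :
    HasPV (fun β => u (β : Torus) * kernel₁ (z α 0 - z β 0) (z α 1 - z β 1)) α (-L.im) ∧
    HasPV (fun β => u (β : Torus) * kernel₂ (z α 0 - z β 0) (z α 1 - z β 1)) α L.re := by
  have e : ∀ β : ℝ, (u (β : Torus) : ℂ) *
      (Complex.cos ((toComplex (z α) - toComplex (z β)) / 2) /
        Complex.sin ((toComplex (z α) - toComplex (z β)) / 2)) =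
      (u (β : Torus) : ℂ) * (kernel₂ (z α 0 - z β 0) (z α 1 - z β 1)
        - kernel₁ (z α 0 - z β 0) (z α 1 - z β 1) * Complex.I) := by
    intro β
    rw [← cos_div_sin_eq_kernel, toComplex_apply, toComplex_apply]
    push_cast
    ring_nf
  simp only [e] at hi hL
  have ere : ∀ β : ℝ, ((u (β : Torus) : ℂ) * (kernel₂ (z α 0 - z β 0) (z α 1 - z β 1)
        - kernel₁ (z α 0 - z β 0) (z α 1 - z β 1) * Complex.I)).re
      = u (β : Torus) * kernel₂ (z α 0 - z β 0) (z α 1 - z β 1) := by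
    intro β; simp
  have eim : ∀ β : ℝ, -((u (β : Torus) : ℂ) * (kernel₂ (z α 0 - z β 0) (z α 1 - z β 1)
        - kernel₁ (z α 0 - z β 0) (z α 1 - z β 1) * Complex.I)).im
      = u (β : Torus) * kernel₁ (z α 0 - z β 0) (z α 1 - z β 1) := by
    intro β; simp
  simp only [← ere, ← eim]
  refine ⟨⟨fun ε hε => (hi ε hε).im.neg, ?_⟩, ⟨fun ε hε => (hi ε hε).re, ?_⟩⟩
  · refine ((Complex.continuous_im.tendsto _).comp hL).neg.congr' ?_
    filter_upwards [self_mem_nhdsWithin] with ε hε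
    have := Complex.imCLM.integral_comp_comm (hi ε hε)
    simp only [Complex.imCLM_apply] at this
    rw [Function.comp_apply, ← this, ← integral_neg]
    rfl
  · refine ((Complex.continuous_re.tendsto _).comp hL).congr' ?_
    filter_upwards [self_mem_nhdsWithin] with ε hε
    have := Complex.reCLM.integral_comp_comm (hi ε hε)
    simp only [Complex.reCLM_apply] at this
    rw [Function.comp_apply, ← this]
    rfl

/-- Uniqueness of limits makes the choice inside `BR` immaterial; the dot product with the tangent
is then the imaginary part of a complex product. -/
theorem opT_eq {z : ℝ → Plane} {u : Torus → ℝ} {α : ℝ} {L : ℂ}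
    (h₁ : HasPV (fun β => u (β : Torus) * kernel₁ (z α 0 - z β 0) (z α 1 - z β 1)) α (-L.im))
    (h₂ : HasPV (fun β => u (β : Torus) * kernel₂ (z α 0 - z β 0) (z α 1 - z β 1)) α L.re) :
    opT z u α = (2 * π)⁻¹ * (L * toComplex (deriv z α)).im := by
  have hex : ∃ b, HasBR z u α b := ⟨_, _, _, h₁, h₂, rfl⟩
  obtain ⟨l₁, l₂, p₁, p₂, hb⟩ := hex.choose_spec
  have e₁ : l₁ = -L.im := tendsto_nhds_unique p₁.2 h₁.2
  have e₂ : l₂ = L.re := tendsto_nhds_unique p₂.2 h₂.2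
  have hp := Real.pi_ne_zero
  rw [opT, BR, dif_pos hex, hb, e₁, e₂, toComplex_apply, PiLp.inner_apply, Fin.sum_univ_two]
  simp
  field_simp
  ring

/-- The constant of the main estimate. -/
def mainConst (δ : ℝ) : ℝ := 12 * 640 * 32 * (∫⁻ a, weight δ a).toReal

theorem exists_operator {δ : ℝ≥0} (hδ : 0 < δ) {z : ℝ → Plane} (hz : IsPeriodicCurve z)
    (h : IsC2Holder δ z) (hF : arcChordNorm z ≠ ⊤) :
    ∃ A : L2 →L[ℝ] H1,
      (∀ u : L2, ∀ᵐ α : ℝ, (∃ b, HasBR z u α b) ∧ H1.toL2 (A u) (α : Torus) = opT z u α) ∧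
      ‖A‖ ≤ mainConst δ * (arcChordNorm z).toReal ^ 2 * (c2HolderNorm δ z).toReal ^ 4 := by
  have H := isChordArc hδ hz h hF
  have hl := le_arcChordNorm hz h.1.continuous hF
  obtain ⟨A, hA, hAn⟩ := IsDominated.exists_toH1 H.isDominated_torusKernel
    H.isDominated_torusKernelDeriv fun φ hφ hper b => H.integral_torusKernel_mul_deriv hφ hper b
  have hp := Real.two_pi_pos
  refine ⟨(2 * π)⁻¹ • A, fun u => ?_, ?_⟩
  · have hsm : ∀ᵐ a : Torus, H1.toL2 (((2 * π)⁻¹ • A) u) a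
        = (2 * π)⁻¹ * kernelOp (IsChordArc.torusKernel (fun α => toComplex (z α))
          fun α => toComplex (deriv z α)) u a := by
      filter_upwards [hA u, Lp.coeFn_smul (2 * π)⁻¹ (H1.toL2 (A u))] with a h1 h2
      rw [← h1]
      exact h2
    filter_upwards [ae_real_of_ae_torus hsm, ae_exists_tendsto_truncCot u] with α h1 h2
    obtain ⟨l, hl⟩ := h2
    have hu : IntegrableOn (fun β : ℝ => (u (β : Torus) : ℂ)) (period α) :=
      integrableOn_period_comp_coe (g := fun a => (u a : ℂ))
        ((Lp.memLp u).integrable (by norm_num)).ofReal α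
    obtain ⟨L, hL⟩ := H.exists_tendsto_cot (u := fun β => u (β : Torus)) hu hl
    obtain ⟨p₁, p₂⟩ := hasBR_of_tendsto (z := z)
      (fun ε hε => H.integrable_cotKernel_mul (u := fun β => u (β : Torus)) hε hu) hL
    refine ⟨⟨_, _, _, p₁, p₂, rfl⟩, ?_⟩
    rw [h1, opT_eq p₁ p₂, H.tendsto_im_cotKernel_mul (u := fun β => u (β : Torus)) hu hL]
    congr 1
    unfold kernelOp
    rw [integral_torus_eq _ (α - π), show α - π + 2 * π = α + π by ring,
      intervalIntegral.integral_of_le (by linarith), integral_Ioc_eq_integral_Ioo, ← period_eq]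
    refine integral_congr_ae (Eventually.of_forall fun β => ?_)
    simp only
    rw [H.torusKernel_coe]
  · set F := (arcChordNorm z).toReal
    set M := (c2HolderNorm δ z).toReal
    set W := (∫⁻ a, weight δ a).toReal with hW
    have hM := H.M_pos
    have hW0 : 0 ≤ W := ENNReal.toReal_nonneg
    have e : (∫⁻ a, ENNReal.ofReal (6 * (640 * F) * M ^ 4) * weight δ a).toReal
        = 6 * (640 * F) * M ^ 4 * W := by
      rw [lintegral_const_mul _ (measurable_weight δ), ENNReal.toReal_mul,
        ENNReal.toReal_ofReal (by positivity)]
    rw [e] at hAn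
    have h1 : (2 * π)⁻¹ ≤ 1 := inv_le_one_of_one_le₀ (by linarith [Real.pi_gt_three])
    calc ‖(2 * π)⁻¹ • A‖ ≤ 1 * ‖A‖ := by
          refine (ContinuousLinearMap.opNorm_smul_le _ _).trans ?_
          rw [Real.norm_of_nonneg (by positivity)]
          gcongr
      -- The 12 is 6 + 6, one contribution from the kernel and one from its derivative.
      _ ≤ 12 * 640 * F * M ^ 4 * W := by linarith
      -- F ≤ 32 F², from F ≥ 1/32.
      _ ≤ 12 * 640 * (32 * F ^ 2) * M ^ 4 * W := by
          gcongr
          nlinarith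
      _ = _ := by rw [mainConst, ← hW]; ring

end Muskat

end

theorem mainTheorem5 (δ : ℝ≥0) (hδ : 0 < δ) :
    ∃ C : ℝ, ∀ z : ℝ → Muskat.Plane, Muskat.IsPeriodicCurve z → Muskat.IsC2Holder δ z →
      Muskat.arcChordNorm z < ⊤ →
      ∃ A : Muskat.L2 →L[ℝ] Muskat.H1,
        (∀ u : Muskat.L2, ∀ᵐ α : ℝ,
          (∃ b, Muskat.HasBR z u α b) ∧
            Muskat.H1.toL2 (A u) (α : Muskat.Torus) = Muskat.opT z u α) ∧
        ‖A‖ ≤ C * (Muskat.arcChordNorm z).toReal ^ 2 * (Muskat.c2HolderNorm δ z).toReal ^ 4 := by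
  refine ⟨Muskat.mainConst δ, fun z hz h hF => ?_⟩
  exact Muskat.exists_operator hδ hz h hF.ne
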